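/- Let $N\ge 1$, $G=\mathrm{SL}_N$ over $\mathbb{C}$, $\mathfrak{g}=\mathfrak{sl}_N$. Identify $\mathfrak g^*$ with $\mathfrak g$ by the Killing form $\kappa(x,y)=2N\,\mathrm{tr}(xy)$, and trivialise $T^*G\cong G\times\mathfrak g^*\ni(g,x)$ by left-invariant vector fields. Its canonical Poisson structure is given by $\{\ell_\xi,\ell_\eta\}=\ell_{[\xi,\eta]}$, $\{\ell_\xi,g\}=g\xi$ (entrywise) and $\{g_{ij},g_{kl}\}=0$, where $\ell_\xi(x)=\kappa(x,\xi)$ for $\xi\in\mathfrak g$. The two commuting actions of $G$ by translations have moment maps $(g,x)\mapsto x$ and $(g,x)\mapsto \mathrm{Ad}_g x$. Let $\mathcal N\subset G$ be the group of upper unitriangular matrices, $\mathfrak n$ its Lie algebra, $f=\sum_{i=1}^{N-1}E_{i+1,i}$ and $\chi=\kappa(f,\cdot)|_{\mathfrak n}$. Let $\mathcal Y\subset T^*G$ be the closed subscheme on which both moment maps restrict to $\chi$ on $\mathfrak n$, that is, on which $x$ and $\mathrm{Ad}_g x$ both lie in $f+\mathfrak b$, with $\mathfrak b$ the upper triangular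 matrices in $\mathfrak g$. The universal centraliser is the two-sided Kostant--Whittaker reduction $\mathfrak Z_G=\mathcal Y/\!\!/(\mathcal N\times\mathcal N)$; its coordinate ring $I_{\mathrm{SL}_N}=\mathbb C[\mathfrak Z_G]=\mathbb C[\mathcal Y]^{\mathcal N\times\mathcal N}$ is a Poisson algebra, the bracket of two elements being the restriction to $\mathcal Y$ of the bracket of any extensions of them to $T^*G$. Let $(P_i)$ be any family of generators of the algebra $\mathbb C[\mathfrak g^*]^G$ (for instance $N-1$ fundamental invariants), regarded as elements of $I_{\mathrm{SL}_N}$ through the moment map $x$, and let $X=g_{N1}$ be the element of $I_{\mathrm{SL}_N}$ given by the lower left matrix entry of $g$. **Theorem.** $I_{\mathrm{SL}_N}$ is generated as a Poisson algebra by the $P_i$ and $X$: the smallest unital subalgebra of $I_{\mathrm{SL}_N}$ that contains $X$ and all $P_i$ and is closed under the Poisson bracket is $I_{\mathrm{SL}_N}$ itself. -/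

import Mathlib

noncomputable section

namespace UCent

open Matrix

/-! ### Poisson algebras -/

/-- A (commutative) Poisson algebra over `ℂ`, with bracket `pb`. -/
class PoissonAlg (A : Type*) [CommRing A] [Algebra ℂ A] where
  pb : A → A → A
  pb_add : ∀ a b c, pb a (b + c) = pb a b + pb a c
  pb_smul : ∀ (r : ℂ) (a b : A), pb a (r • b) = r • pb a b
  pb_skew : ∀ a b, pb a b = - pb b a
  pb_mul : ∀ a b c, pb a (b * c) = pb a b * c + b * pb a c
  pb_jacobi : ∀ a b c, pb a (pb b c) = pb (pb a b) c + pb b (pb a c)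


section Generic

variable {A : Type*} [CommRing A] [Algebra ℂ A] [PoissonAlg A]

open PoissonAlg

/-- The Hamiltonian derivation `{a, ·}`. -/
def ham (a : A) : Derivation ℂ A A :=
  Derivation.mk'
    { toFun := pb a
      map_add' := pb_add a
      map_smul' := fun r b => pb_smul r a b }
    (fun b c => by
      change pb a (b * c) = b • pb a c + c • pb a b
      rw [pb_mul, smul_eq_mul, smul_eq_mul]; ring)

theorem ham_apply (a b : A) : ham a b = pb a b := rfl

theorem pb_add_left (a b c : A) : pb (a + b) c = pb a c + pb b c := by
  rw [pb_skew, pb_add, pb_skew c a, pb_skew c b]; ring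

theorem pb_smul_left (r : ℂ) (a b : A) : pb (r • a) b = r • pb a b := by
  rw [pb_skew, pb_smul, pb_skew b a]; simp

theorem pb_mul_left (a b c : A) : pb (a * b) c = pb a c * b + a * pb b c := by
  rw [pb_skew, pb_mul, pb_skew c a, pb_skew c b]; ring

theorem pb_sub (a b c : A) : pb a (b - c) = pb a b - pb a c := (ham a).map_sub b c

theorem pb_sub_left (a b c : A) : pb (a - b) c = pb a c - pb b c := by
  rw [pb_skew, pb_sub, pb_skew c a, pb_skew c b]; ring

theorem pb_zero (a : A) : pb a 0 = 0 := (ham a).map_zero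

theorem pb_algebraMap (a : A) (r : ℂ) : pb a (algebraMap ℂ A r) = 0 :=
  (ham a).map_algebraMap r

theorem pb_algebraMap_left (a : A) (r : ℂ) : pb (algebraMap ℂ A r) a = 0 := by
  rw [pb_skew, pb_algebraMap, neg_zero]

/-- If `{a, ·}` sends generators of an ideal into the ideal, it preserves the ideal. -/
theorem pb_mem_span {s : Set A} (a : A) (h : ∀ b ∈ s, pb a b ∈ Ideal.span s) {b : A}
    (hb : b ∈ Ideal.span s) : pb a b ∈ Ideal.span s := by
  induction hb using Submodule.span_induction with
  | mem x hx => exact h x hx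
  | zero => rw [pb_zero]; exact Ideal.zero_mem _
  | add x y _ _ hx hy => rw [pb_add]; exact Ideal.add_mem _ hx hy
  | smul r x hx hx' =>
    rw [smul_eq_mul, pb_mul]
    exact Ideal.add_mem _ (Ideal.mul_mem_left _ _ hx) (Ideal.mul_mem_left _ _ hx')

/-- The quotient of a Poisson algebra by a Poisson ideal, with `{[a], [b]} = [{a, b}]`. -/
abbrev quotientPoisson (I : Ideal A) (hI : ∀ a, ∀ b ∈ I, pb a b ∈ I) : PoissonAlg (A ⧸ I) where
  pb := Quotient.lift₂ (fun a b => Ideal.Quotient.mk I (pb a b)) (by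
    intro a b a' b' ha hb
    have ha' : a - a' ∈ I := by
      have := (Submodule.quotientRel_def I).1 ha
      exact this
    have hb' : b - b' ∈ I := by
      have := (Submodule.quotientRel_def I).1 hb
      exact this
    apply Ideal.Quotient.eq.2
    have e : pb a b - pb a' b' = pb a (b - b') - pb b' (a - a') := by
      rw [pb_sub, pb_sub, pb_skew b' a, pb_skew b' a']; ring
    rw [e]
    exact Ideal.sub_mem _ (hI _ _ hb') (hI _ _ ha'))
  pb_add := by
    rintro ⟨a⟩ ⟨b⟩ ⟨c⟩
    exact congrArg (Ideal.Quotient.mk I) (pb_add a b c)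
  pb_smul := by
    rintro r ⟨a⟩ ⟨b⟩
    exact congrArg (Ideal.Quotient.mk I) (pb_smul r a b)
  pb_skew := by
    rintro ⟨a⟩ ⟨b⟩
    exact congrArg (Ideal.Quotient.mk I) (pb_skew a b)
  pb_mul := by
    rintro ⟨a⟩ ⟨b⟩ ⟨c⟩
    exact congrArg (Ideal.Quotient.mk I) (pb_mul a b c)
  pb_jacobi := by
    rintro ⟨a⟩ ⟨b⟩ ⟨c⟩
    exact congrArg (Ideal.Quotient.mk I) (pb_jacobi a b c)

/-- A subalgebra closed under the bracket is a Poisson algebra. -/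
abbrev subalgebraPoisson (S : Subalgebra ℂ A) (hS : ∀ a ∈ S, ∀ b ∈ S, pb a b ∈ S) :
    PoissonAlg S where
  pb a b := ⟨pb (a : A) (b : A), hS a a.2 b b.2⟩
  pb_add a b c := Subtype.ext (pb_add (a : A) b c)
  pb_smul r a b := Subtype.ext (pb_smul r (a : A) b)
  pb_skew a b := Subtype.ext (pb_skew (a : A) b)
  pb_mul a b c := Subtype.ext (pb_mul (a : A) b c)
  pb_jacobi a b c := Subtype.ext (pb_jacobi (a : A) b c)

variable (A) in
/-- The Poisson subalgebra generated by `s`: the smallest (unital, associative) subalgebra that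
contains `s` and is closed under the bracket. -/
def poissonAdjoin (s : Set A) : Subalgebra ℂ A :=
  sInf {S : Subalgebra ℂ A | s ⊆ S ∧ ∀ a ∈ S, ∀ b ∈ S, pb a b ∈ S}

end Generic

/-! ### Poisson brackets on polynomial rings -/

section Poly

open MvPolynomial

variable {σ : Type*} [Fintype σ]

/-- The biderivation of `ℂ[σ]` with `{X a, X b} = π a b`. -/
def polyPB (π : σ → σ → MvPolynomial σ ℂ) (F H : MvPolynomial σ ℂ) : MvPolynomial σ ℂ :=
  ∑ a, ∑ b, pderiv a F * pderiv b H * π a b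

variable (π : σ → σ → MvPolynomial σ ℂ)

theorem polyPB_X_X (a b : σ) : polyPB π (X a) (X b) = π a b := by
  classical
  simp only [polyPB, pderiv_X]
  rw [Finset.sum_eq_single a, Finset.sum_eq_single b]
  · simp
  · intro c _ hc; simp [Pi.single_eq_of_ne' hc]
  · simp
  · intro c _ hc; simp [Pi.single_eq_of_ne' hc]
  · simp

theorem polyPB_skew (hπ : ∀ a b, π a b = - π b a) (F H : MvPolynomial σ ℂ) :
    polyPB π F H = - polyPB π H F := by
  simp only [polyPB]
  rw [Finset.sum_comm, ← Finset.sum_neg_distrib]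
  refine Finset.sum_congr rfl fun b _ => ?_
  rw [← Finset.sum_neg_distrib]
  refine Finset.sum_congr rfl fun a _ => ?_
  rw [hπ a b]; ring

theorem polyPB_add (F G H : MvPolynomial σ ℂ) :
    polyPB π F (G + H) = polyPB π F G + polyPB π F H := by
  simp only [polyPB, map_add, ← Finset.sum_add_distrib]
  refine Finset.sum_congr rfl fun b _ => Finset.sum_congr rfl fun a _ => ?_
  ring

theorem polyPB_smul (r : ℂ) (F G : MvPolynomial σ ℂ) :
    polyPB π F (r • G) = r • polyPB π F G := by
  simp only [polyPB, Derivation.map_smul, Finset.smul_sum, mul_smul_comm, smul_mul_assoc]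

theorem polyPB_mul (F G H : MvPolynomial σ ℂ) :
    polyPB π F (G * H) = polyPB π F G * H + G * polyPB π F H := by
  simp only [polyPB, Derivation.leibniz, smul_eq_mul, Finset.sum_mul, Finset.mul_sum,
    ← Finset.sum_add_distrib]
  refine Finset.sum_congr rfl fun b _ => Finset.sum_congr rfl fun a _ => ?_
  ring

/-- The derivation `{F, ·}`. -/
def polyHam (F : MvPolynomial σ ℂ) : Derivation ℂ (MvPolynomial σ ℂ) (MvPolynomial σ ℂ) :=
  Derivation.mk'
    { toFun := polyPB π F
      map_add' := polyPB_add π F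
      map_smul' := fun r b => polyPB_smul π r F b }
    (fun b c => by
      change polyPB π F (b * c) = b • polyPB π F c + c • polyPB π F b
      rw [polyPB_mul, smul_eq_mul, smul_eq_mul]; ring)

theorem polyHam_apply (F G : MvPolynomial σ ℂ) : polyHam π F G = polyPB π F G := rfl

/-- The Jacobi identity holds as soon as it holds on the variables. -/
theorem polyPB_jacobi (hπ : ∀ a b, π a b = - π b a)
    (hJ : ∀ a b c, polyPB π (X a) (π b c) = polyPB π (π a b) (X c) + polyPB π (X b) (π a c))
    (F G H : MvPolynomial σ ℂ) :
    polyPB π F (polyPB π G H) = polyPB π (polyPB π F G) H + polyPB π G (polyPB π F H) := by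
  have hn : ∀ F G, polyPB π F (-G) = - polyPB π F G := fun F G => (polyHam π F).map_neg G
  -- the identity for all third arguments follows from that for variables
  have key : ∀ F G : MvPolynomial σ ℂ,
      (∀ c, polyPB π F (polyPB π G (X c))
        = polyPB π (polyPB π F G) (X c) + polyPB π G (polyPB π F (X c))) →
      ∀ H, polyPB π F (polyPB π G H)
        = polyPB π (polyPB π F G) H + polyPB π G (polyPB π F H) := by
    intro F G h H
    have e : ⁅polyHam π F, polyHam π G⁆ = polyHam π (polyPB π F G) := by
      refine MvPolynomial.derivation_ext fun c => ?_
      rw [Derivation.commutator_apply]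
      simp only [polyHam_apply]
      rw [h c]; ring
    have e' := DFunLike.congr_fun e H
    rw [Derivation.commutator_apply] at e'
    simp only [polyHam_apply] at e'
    rw [← e']; ring
  -- cyclic rotation of the identity
  have rot : ∀ F G H : MvPolynomial σ ℂ,
      polyPB π F (polyPB π G H) = polyPB π (polyPB π F G) H + polyPB π G (polyPB π F H) →
      polyPB π G (polyPB π H F) = polyPB π (polyPB π G H) F + polyPB π H (polyPB π G F) := by
    intro F G H h
    rw [polyPB_skew π hπ H F, hn, polyPB_skew π hπ (polyPB π G H) F, h,
      polyPB_skew π hπ G F, hn, polyPB_skew π hπ H (polyPB π F G)]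
    ring
  have s1 : ∀ a b H, polyPB π (X a) (polyPB π (X b) H)
      = polyPB π (polyPB π (X a) (X b)) H + polyPB π (X b) (polyPB π (X a) H) := by
    intro a b
    refine key _ _ fun c => ?_
    simp only [polyPB_X_X]
    exact hJ a b c
  have s2 : ∀ b G H, polyPB π (X b) (polyPB π G H)
      = polyPB π (polyPB π (X b) G) H + polyPB π G (polyPB π (X b) H) := by
    intro b G
    refine key _ _ fun c => ?_
    exact rot _ _ _ (s1 c b G)
  exact key F G (fun c => rot _ _ _ (s2 c F G)) H

/-- The polynomial Poisson algebra with `{X a, X b} = π a b`. -/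
abbrev polyPoisson (hπ : ∀ a b, π a b = - π b a)
    (hJ : ∀ a b c, polyPB π (X a) (π b c) = polyPB π (π a b) (X c) + polyPB π (X b) (π a c)) :
    PoissonAlg (MvPolynomial σ ℂ) where
  pb := polyPB π
  pb_add := polyPB_add π
  pb_smul := polyPB_smul π
  pb_skew := polyPB_skew π hπ
  pb_mul := polyPB_mul π
  pb_jacobi := polyPB_jacobi π hπ hJ

end Poly

/-! ### The Poisson algebra of functions on the cotangent bundle of `SL_N` -/

section Cotangent

open MvPolynomial

variable (N : ℕ)

/-- Names of the coordinates: `inl (i, j)` is the matrix entry `x_ij` and `inr (i, j)` the matrix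
entry `g_ij`. -/
abbrev Coord : Type := (Fin N × Fin N) ⊕ (Fin N × Fin N)

/-- The Kronecker delta. -/
abbrev kd (i j : Fin N) : ℂ := (1 : Matrix (Fin N) (Fin N) ℂ) i j

/-- The brackets of the coordinates of `T^*SL_N = 𝔤^* × SL_N` (left-invariant vector fields), where
`𝔤^*` is identified with `𝔤 = sl_N` by the Killing form `κ(x, y) = 2N tr(xy)`.
For the linear functions `ℓ_ξ(x) = κ(x, ξ)` with `ξ ∈ sl_N`, these formulas say
`{ℓ_ξ, ℓ_η} = ℓ_[ξ,η]`, `{ℓ_ξ, g} = g ξ` (entrywise), `{g_ij, g_kl} = 0`: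
see `pb_ell_ell`, `pb_ell_g` and `pb_g_g` below. -/
def table : Coord N → Coord N → MvPolynomial (Coord N) ℂ
  | .inl (i, j), .inl (k, l) =>
      C (1 / (2 * N) : ℂ) * (C (kd N i l) * X (.inl (k, j)) - C (kd N k j) * X (.inl (i, l)))
  | .inl (i, j), .inr (k, l) =>
      C (1 / (2 * N) : ℂ) *
        (C (kd N i l) * X (.inr (k, j)) - C (1 / N : ℂ) * C (kd N i j) * X (.inr (k, l)))
  | .inr (k, l), .inl (i, j) =>
      - (C (1 / (2 * N) : ℂ) *
        (C (kd N i l) * X (.inr (k, j)) - C (1 / N : ℂ) * C (kd N i j) * X (.inr (k, l))))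
  | .inr _, .inr _ => 0

theorem table_skew (a b : Coord N) : table N a b = - table N b a := by
  rcases a with ⟨i, j⟩ | ⟨i, j⟩ <;> rcases b with ⟨k, l⟩ | ⟨k, l⟩ <;> simp only [table] <;> ring

theorem table_jacobi (a b c : Coord N) :
    polyPB (table N) (X a) (table N b c)
      = polyPB (table N) (table N a b) (X c) + polyPB (table N) (X b) (table N a c) := by
  rw [polyPB_skew _ (table_skew N) (table N a b) (X c)]
  simp only [← polyHam_apply]
  have hX : ∀ a b, polyHam (table N) (X a) (X b) = table N a b := fun a b => polyPB_X_X _ a b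
  have hC : ∀ a (r : ℂ), polyHam (table N) (X a) (C r) = 0 := fun a r =>
    (polyHam (table N) (X a)).map_algebraMap r
  rcases a with ⟨i, j⟩ | ⟨i, j⟩ <;> rcases b with ⟨k, l⟩ | ⟨k, l⟩ <;>
    rcases c with ⟨m, n⟩ | ⟨m, n⟩ <;>
    simp only [table, Derivation.leibniz, map_sub, map_neg, map_zero, hX, hC, smul_eq_mul] <;> ring

/-- The coordinate ring of `gl_N × Mat_N` with these brackets. -/
instance ambientPoisson : PoissonAlg (MvPolynomial (Coord N) ℂ) :=
  polyPoisson (table N) (table_skew N) (table_jacobi N)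


/-- The matrix of coordinates `x_ij` in `ℂ[x, g]`. -/
def polyX : Matrix (Fin N) (Fin N) (MvPolynomial (Coord N) ℂ) := .of fun i j => X (.inl (i, j))

/-- The matrix of coordinates `g_ij` in `ℂ[x, g]`. -/
def polyG : Matrix (Fin N) (Fin N) (MvPolynomial (Coord N) ℂ) := .of fun i j => X (.inr (i, j))

/-- The ideal of `sl_N × SL_N` in `gl_N × Mat_N`: `tr x = 0` and `det g = 1`. -/
def slIdeal : Ideal (MvPolynomial (Coord N) ℂ) :=
  Ideal.span {(polyX N).trace, (polyG N).det - 1}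

theorem pb_xx (i j k l : Fin N) : PoissonAlg.pb (polyX N i j) (polyX N k l) =
    C (1 / (2 * N) : ℂ) * (C (kd N i l) * polyX N k j - C (kd N k j) * polyX N i l) :=
  polyPB_X_X _ _ _

theorem pb_xg (i j k l : Fin N) : PoissonAlg.pb (polyX N i j) (polyG N k l) =
    C (1 / (2 * N) : ℂ) *
      (C (kd N i l) * polyG N k j - C (1 / N : ℂ) * C (kd N i j) * polyG N k l) :=
  polyPB_X_X _ _ _

theorem pb_gg (i j k l : Fin N) : PoissonAlg.pb (polyG N i j) (polyG N k l) = 0 :=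
  polyPB_X_X _ _ _

/-- A derivation as the linear term of an algebra homomorphism `F ↦ F + t D F + ⋯`. -/
theorem coeff_flow (D : Derivation ℂ (MvPolynomial (Coord N) ℂ) (MvPolynomial (Coord N) ℂ))
    (F : MvPolynomial (Coord N) ℂ) :
    (aeval (fun s => Polynomial.C (X s) + Polynomial.X * Polynomial.C (D (X s))) F :
      Polynomial (MvPolynomial (Coord N) ℂ)).coeff 0 = F ∧
    (aeval (fun s => Polynomial.C (X s) + Polynomial.X * Polynomial.C (D (X s))) F :
      Polynomial (MvPolynomial (Coord N) ℂ)).coeff 1 = D F := by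
  induction F using MvPolynomial.induction_on with
  | C r =>
    rw [← MvPolynomial.algebraMap_eq, AlgHom.commutes, Derivation.map_algebraMap,
      Polynomial.algebraMap_apply]
    simp [Polynomial.coeff_C]
  | add p q hp hq => simp only [map_add, Polynomial.coeff_add, hp.1, hp.2, hq.1, hq.2, and_self]
  | mul_X p s hp =>
    rw [map_mul, aeval_X, Polynomial.mul_coeff_zero, Polynomial.mul_coeff_one, hp.1, hp.2]
    simp [Derivation.leibniz, Polynomial.coeff_C]
    ring

theorem derivation_det (D : Derivation ℂ (MvPolynomial (Coord N) ℂ) (MvPolynomial (Coord N) ℂ))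
    (E : Matrix (Fin N) (Fin N) (MvPolynomial (Coord N) ℂ))
    (h : ∀ k l, D (polyG N k l) = (polyG N * E) k l) :
    D (polyG N).det = (polyG N).det * E.trace := by
  rw [← (coeff_flow N D _).2, AlgHom.map_det]
  have e : (aeval (fun s => Polynomial.C (X s) + Polynomial.X * Polynomial.C (D (X s)))
        : _ →ₐ[ℂ] Polynomial (MvPolynomial (Coord N) ℂ)).mapMatrix (polyG N)
      = (polyG N).map Polynomial.C *
        (1 + (Polynomial.X : Polynomial (MvPolynomial (Coord N) ℂ)) • E.map Polynomial.C) := by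
    rw [mul_add, mul_one, Matrix.mul_smul, ← Matrix.map_mul]
    ext1 k l
    have := h k l
    simp only [polyG, of_apply] at this
    simp only [AlgHom.mapMatrix_apply, map_apply, polyG, of_apply, aeval_X, this, Matrix.add_apply,
      Matrix.smul_apply, smul_eq_mul]
  rw [e, Matrix.det_mul, ← RingHom.mapMatrix_apply, ← RingHom.map_det, Polynomial.coeff_C_mul,
    Matrix.coeff_det_one_add_X_smul_one]

theorem pb_det (F : MvPolynomial (Coord N) ℂ) : PoissonAlg.pb F (polyG N).det = 0 := by
  have main : ham (polyG N).det = 0 := by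
    refine MvPolynomial.derivation_ext fun s => ?_
    rw [ham_apply, PoissonAlg.pb_skew, ← ham_apply]
    rcases s with ⟨i, j⟩ | ⟨i, j⟩
    · rw [derivation_det N _ (.of fun m l => C (1 / (2 * N) : ℂ) *
        (C (kd N i l) * C (kd N m j) - C (1 / N : ℂ) * C (kd N i j) * C (kd N m l)))]
      · have hN : (N : ℂ) ≠ 0 := by
          have := i.pos
          exact_mod_cast this.ne'
        have : (Matrix.of fun m l => (C (1 / (2 * N) : ℂ) *
            (C (kd N i l) * C (kd N m j) - C (1 / N : ℂ) * C (kd N i j) * C (kd N m l)) :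
              MvPolynomial (Coord N) ℂ)).trace = 0 := by
          simp only [Matrix.trace, diag_apply, of_apply, ← map_mul, ← map_sub, ← map_sum]
          rw [← Finset.mul_sum, Finset.sum_sub_distrib]
          simp [kd, Matrix.one_apply, hN]
        rw [this]; simp
      · intro k l
        rw [ham_apply]
        refine (pb_xg N i j k l).trans ?_
        simp only [Matrix.mul_apply, of_apply, mul_left_comm _ (C (1 / (2 * N) : ℂ) : MvPolynomial (Coord N) ℂ),
          ← Finset.mul_sum]
        congr 1
        simp [mul_sub, Finset.sum_sub_distrib, kd, Matrix.one_apply, apply_ite C, mul_comm]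
    · rw [derivation_det N _ 0]
      · simp
      · intro k l
        rw [ham_apply, Matrix.mul_zero]
        exact pb_gg N i j k l
  rw [PoissonAlg.pb_skew, ← ham_apply, main]; simp

theorem pb_tr (F : MvPolynomial (Coord N) ℂ) : PoissonAlg.pb F (polyX N).trace = 0 := by
  have main : ham (polyX N).trace = 0 := by
    refine MvPolynomial.derivation_ext fun s => ?_
    rw [ham_apply, PoissonAlg.pb_skew, ← ham_apply, Matrix.trace, map_sum]
    rcases s with ⟨i, j⟩ | ⟨k, l⟩
    · have : ∀ k, ham (X (.inl (i, j)) : MvPolynomial (Coord N) ℂ) (polyX N k k) = _ :=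
        fun k => pb_xx N i j k k
      simp only [diag_apply, this]
      rw [← Finset.mul_sum]
      simp [kd, Matrix.one_apply, apply_ite C]
    · have : ∀ i, ham (X (.inr (k, l)) : MvPolynomial (Coord N) ℂ) (polyX N i i) = _ :=
        fun i => (PoissonAlg.pb_skew _ _).trans (congrArg _ (pb_xg N i i k l))
      have hN : (N : ℂ) ≠ 0 := by
        have := k.pos
        exact_mod_cast this.ne'
      simp only [diag_apply, this]
      rw [Finset.sum_neg_distrib, ← Finset.mul_sum, Finset.sum_sub_distrib]
      have h1 : (C (N : ℂ)⁻¹ * (N : MvPolynomial (Coord N) ℂ)) = 1 := by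
        rw [← map_natCast (C : ℂ →+* MvPolynomial (Coord N) ℂ), ← map_mul, inv_mul_cancel₀ hN, map_one]
      simp [kd, Matrix.one_apply, apply_ite C]
      rw [← mul_assoc, mul_comm (N : MvPolynomial (Coord N) ℂ), h1]
      simp
  rw [PoissonAlg.pb_skew, ← ham_apply, main]; simp

/-- The coordinate ring `ℂ[T^*SL_N] = ℂ[𝔤^* × SL_N]`. -/
def CotSL : Type := MvPolynomial (Coord N) ℂ ⧸ slIdeal N

instance : CommRing (CotSL N) := inferInstanceAs (CommRing (MvPolynomial (Coord N) ℂ ⧸ slIdeal N))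

instance : Algebra ℂ (CotSL N) :=
  inferInstanceAs (Algebra ℂ (MvPolynomial (Coord N) ℂ ⧸ slIdeal N))

/-- Restriction of polynomials in the coordinates to functions on `T^*SL_N`. -/
def cotMk : MvPolynomial (Coord N) ℂ →ₐ[ℂ] CotSL N := Ideal.Quotient.mkₐ ℂ (slIdeal N)

theorem cotMk_surjective : Function.Surjective (cotMk N) := Ideal.Quotient.mk_surjective

theorem cotMk_eq_zero {a : MvPolynomial (Coord N) ℂ} : cotMk N a = 0 ↔ a ∈ slIdeal N :=
  Ideal.Quotient.eq_zero_iff_mem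

/-- The Poisson algebra `ℂ[T^*SL_N]`. -/
instance cotPoisson : PoissonAlg (CotSL N) :=
  quotientPoisson (slIdeal N) fun a _ hb => pb_mem_span a (by
    rintro _ (rfl | rfl)
    · rw [pb_tr]; exact Ideal.zero_mem _
    · rw [pb_sub, pb_det, ← map_one (algebraMap ℂ _), pb_algebraMap, sub_zero]
      exact Ideal.zero_mem _) hb

/-- The matrix of coordinate functions `x_ij` on `T^*SL_N`. -/
def matX : Matrix (Fin N) (Fin N) (CotSL N) := (polyX N).map (cotMk N)

/-- The matrix of coordinate functions `g_ij` on `T^*SL_N`. -/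
def matG : Matrix (Fin N) (Fin N) (CotSL N) := (polyG N).map (cotMk N)

theorem trace_matX : (matX N).trace = 0 := by
  have : (matX N).trace = cotMk N (polyX N).trace := by
    simp [Matrix.trace, matX]
  rw [this, cotMk_eq_zero]
  exact Ideal.subset_span (Or.inl rfl)

theorem det_matG : (matG N).det = 1 := by
  rw [matG, ← AlgHom.mapMatrix_apply, ← AlgHom.map_det, ← sub_eq_zero, ← map_one (cotMk N),
    ← map_sub, cotMk_eq_zero]
  exact Ideal.subset_span (Or.inr rfl)

variable {N}

/-- The universal property of `ℂ[T^*SL_N]` as an algebra: pairs of a traceless matrix and a matrix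
of determinant `1`. -/
def cotLift {B : Type*} [CommRing B] [Algebra ℂ B] (x g : Matrix (Fin N) (Fin N) B)
    (hx : x.trace = 0) (hg : g.det = 1) : CotSL N →ₐ[ℂ] B :=
  Ideal.Quotient.liftₐ (slIdeal N)
    (aeval (Sum.elim (fun p => x p.1 p.2) (fun p => g p.1 p.2))) (by
      have e1 : (aeval (Sum.elim (fun p => x p.1 p.2) (fun p => g p.1 p.2)) :
          MvPolynomial (Coord N) ℂ →ₐ[ℂ] B).mapMatrix (polyG N) = g := by
        ext i j; simp [polyG]
      have h : slIdeal N ≤ RingHom.ker (aeval (Sum.elim (fun p => x p.1 p.2)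
          (fun p => g p.1 p.2)) : MvPolynomial (Coord N) ℂ →ₐ[ℂ] B) := by
        refine Ideal.span_le.2 ?_
        rintro _ (rfl | rfl)
        · rw [SetLike.mem_coe, RingHom.mem_ker, ← hx]
          simp [Matrix.trace, polyX]
        · rw [SetLike.mem_coe, RingHom.mem_ker, map_sub, AlgHom.map_det, e1, hg, map_one, sub_self]
      intro a ha
      exact h ha)

section Lift

variable {B : Type*} [CommRing B] [Algebra ℂ B] (x g : Matrix (Fin N) (Fin N) B)
    (hx : x.trace = 0) (hg : g.det = 1)

theorem cotLift_X (i j : Fin N) : cotLift x g hx hg (matX N i j) = x i j := by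
  change aeval _ (X (Sum.inl (i, j)) : MvPolynomial (Coord N) ℂ) = _
  simp

theorem cotLift_G (i j : Fin N) : cotLift x g hx hg (matG N i j) = g i j := by
  change aeval _ (X (Sum.inr (i, j)) : MvPolynomial (Coord N) ℂ) = _
  simp

end Lift

theorem cot_induction {p : CotSL N → Prop} (hC : ∀ r : ℂ, p (algebraMap ℂ _ r))
    (hX : ∀ i j, p (matX N i j)) (hG : ∀ i j, p (matG N i j))
    (hadd : ∀ a b, p a → p b → p (a + b)) (hmul : ∀ a b, p a → p b → p (a * b))
    (F : CotSL N) : p F := by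
  obtain ⟨F, rfl⟩ := cotMk_surjective N F
  induction F using MvPolynomial.induction_on with
  | C r => exact hC r
  | add a b ha hb => rw [map_add]; exact hadd _ _ ha hb
  | mul_X a s ha =>
    rw [map_mul]
    refine hmul _ _ ha ?_
    rcases s with ⟨i, j⟩ | ⟨i, j⟩
    · exact hX i j
    · exact hG i j

/-- A complex matrix as a matrix of constant functions on `T^*SL_N`. -/
def cst (M : Matrix (Fin N) (Fin N) ℂ) : Matrix (Fin N) (Fin N) (CotSL N) :=
  M.map (algebraMap ℂ (CotSL N))

theorem cst_mul (M M' : Matrix (Fin N) (Fin N) ℂ) : cst (M * M') = cst M * cst M' :=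
  Matrix.map_mul

theorem cst_one : cst (1 : Matrix (Fin N) (Fin N) ℂ) = 1 := by
  simp [cst]

theorem det_cst (h : SpecialLinearGroup (Fin N) ℂ) : (cst h.1).det = 1 := by
  rw [cst, ← RingHom.mapMatrix_apply, ← RingHom.map_det, h.2, map_one]

theorem val_mul_inv (h : SpecialLinearGroup (Fin N) ℂ) : h.1 * h⁻¹.1 = 1 :=
  congrArg Subtype.val (mul_inv_cancel h)

theorem val_inv_mul (h : SpecialLinearGroup (Fin N) ℂ) : h⁻¹.1 * h.1 = 1 :=
  congrArg Subtype.val (inv_mul_cancel h)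

theorem cst_mul_inv (h : SpecialLinearGroup (Fin N) ℂ) : cst h.1 * cst h⁻¹.1 = 1 := by
  rw [← cst_mul, val_mul_inv, cst_one]

theorem cst_inv_mul (h : SpecialLinearGroup (Fin N) ℂ) : cst h⁻¹.1 * cst h.1 = 1 := by
  rw [← cst_mul, val_inv_mul, cst_one]

/-- Right translation: the pullback of functions along `(g, x) ↦ (g h, Ad_{h⁻¹} x)`. -/
def rightTr (h : SpecialLinearGroup (Fin N) ℂ) : CotSL N →ₐ[ℂ] CotSL N :=
  cotLift (cst h⁻¹.1 * matX N * cst h.1) (matG N * cst h.1)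
    (by rw [Matrix.trace_mul_comm, ← mul_assoc, cst_mul_inv, one_mul, trace_matX])
    (by rw [Matrix.det_mul, det_matG, det_cst, one_mul])

/-- Left translation: the pullback of functions along `(g, x) ↦ (h g, x)`. -/
def leftTr (h : SpecialLinearGroup (Fin N) ℂ) : CotSL N →ₐ[ℂ] CotSL N :=
  cotLift (matX N) (cst h.1 * matG N) (trace_matX N)
    (by rw [Matrix.det_mul, det_matG, det_cst, one_mul])

/-- The linear function `ℓ_ξ(x) = κ(x, ξ) = 2N tr(x ξ)`. -/
def ell (ξ : Matrix (Fin N) (Fin N) ℂ) : CotSL N := (2 * N : ℂ) • (matX N * cst ξ).trace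

theorem map_derivation_mul (D : Derivation ℂ (CotSL N) (CotSL N))
    (M M' : Matrix (Fin N) (Fin N) (CotSL N)) :
    (M * M').map D = M.map D * M' + M * M'.map D := by
  ext i j
  simp only [map_apply, Matrix.mul_apply, map_sum, Derivation.leibniz, smul_eq_mul,
    Matrix.add_apply, ← Finset.sum_add_distrib]
  refine Finset.sum_congr rfl fun k _ => ?_
  ring

theorem map_derivation_cst (D : Derivation ℂ (CotSL N) (CotSL N)) (ξ : Matrix (Fin N) (Fin N) ℂ) :
    (cst ξ).map D = 0 := by
  ext i j
  exact D.map_algebraMap _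

theorem pb_matX_matX (i j k l : Fin N) : PoissonAlg.pb (matX N i j) (matX N k l) =
    algebraMap ℂ _ (1 / (2 * N) : ℂ) *
      (algebraMap ℂ _ (kd N i l) * matX N k j - algebraMap ℂ _ (kd N k j) * matX N i l) :=
  congrArg (cotMk N) (pb_xx N i j k l)

theorem pb_matX_matG (i j k l : Fin N) : PoissonAlg.pb (matX N i j) (matG N k l) =
    algebraMap ℂ _ (1 / (2 * N) : ℂ) * (algebraMap ℂ _ (kd N i l) * matG N k j -
      algebraMap ℂ _ (1 / N : ℂ) * algebraMap ℂ _ (kd N i j) * matG N k l) :=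
  congrArg (cotMk N) (pb_xg N i j k l)

theorem pb_g_g (i j k l : Fin N) : PoissonAlg.pb (matG N i j) (matG N k l) = 0 :=
  congrArg (cotMk N) (pb_gg N i j k l)

theorem pb_ell (ξ : Matrix (Fin N) (Fin N) ℂ) (F : CotSL N) :
    PoissonAlg.pb (ell ξ) F =
      ∑ i, ∑ j, algebraMap ℂ _ (2 * N * ξ j i : ℂ) * PoissonAlg.pb (matX N i j) F := by
  rw [PoissonAlg.pb_skew, ← ham_apply, ell, Derivation.map_smul, Matrix.trace, map_sum,
    Finset.smul_sum, ← Finset.sum_neg_distrib]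
  refine Finset.sum_congr rfl fun i _ => ?_
  rw [diag_apply, Matrix.mul_apply, map_sum, Finset.smul_sum, ← Finset.sum_neg_distrib]
  refine Finset.sum_congr rfl fun j _ => ?_
  have : ham F (cst ξ j i) = 0 := (ham F).map_algebraMap _
  rw [Derivation.leibniz, this, ham_apply, PoissonAlg.pb_skew F, Algebra.smul_def, cst, map_apply,
    map_mul _ (2 * N : ℂ) (ξ j i)]
  simp only [smul_eq_mul]
  ring

theorem cN {N : ℕ} (i : Fin N) : (2 * N : ℂ) ≠ 0 := by
  have := i.pos
  simp only [ne_eq, mul_eq_zero, OfNat.ofNat_ne_zero, Nat.cast_eq_zero, false_or]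
  exact this.ne'

/-- The coadjoint action: `{ℓ_ξ, x} = [x, ξ]`. -/
theorem ham_ell_X (ξ : Matrix (Fin N) (Fin N) ℂ) :
    (matX N).map (ham (ell ξ)) = matX N * cst ξ - cst ξ * matX N := by
  ext k l
  have h0 := cN k
  rw [map_apply, ham_apply, pb_ell]
  have : ∀ i j, algebraMap ℂ (CotSL N) (2 * N * ξ j i : ℂ) * PoissonAlg.pb (matX N i j) (matX N k l)
      = algebraMap ℂ _ (ξ j i) * (algebraMap ℂ _ (kd N i l) * matX N k j
        - algebraMap ℂ _ (kd N k j) * matX N i l) := by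
    intro i j
    rw [pb_matX_matX, ← mul_assoc, ← map_mul]
    have : (2 * N * ξ j i * (1 / (2 * N)) : ℂ) = ξ j i := by
      rw [mul_right_comm, mul_one_div_cancel h0, one_mul]
    rw [this]
  simp only [this, mul_sub, Finset.sum_sub_distrib]
  simp [Matrix.sub_apply, Matrix.mul_apply, cst, kd, Matrix.one_apply, apply_ite (algebraMap ℂ (CotSL N)),
    mul_comm]

/-- `{ℓ_ξ, g} = g (ξ - (tr ξ / N))`. -/
theorem ham_ell_G (ξ : Matrix (Fin N) (Fin N) ℂ) :
    (matG N).map (ham (ell ξ)) = matG N * cst ξ - (ξ.trace / N) • matG N := by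
  ext k l
  have h0 := cN k
  rw [map_apply, ham_apply, pb_ell]
  have : ∀ i j, algebraMap ℂ (CotSL N) (2 * N * ξ j i : ℂ) * PoissonAlg.pb (matX N i j) (matG N k l)
      = algebraMap ℂ _ (ξ j i) * (algebraMap ℂ _ (kd N i l) * matG N k j)
        - algebraMap ℂ _ (1 / N * (ξ j i * kd N i j) : ℂ) * matG N k l := by
    intro i j
    rw [pb_matX_matG, ← mul_assoc, ← map_mul]
    have : (2 * N * ξ j i * (1 / (2 * N)) : ℂ) = ξ j i := by
      rw [mul_right_comm, mul_one_div_cancel h0, one_mul]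
    rw [this, map_mul, map_mul]
    ring
  simp only [this, Finset.sum_sub_distrib]
  rw [← Finset.sum_comm]
  simp only [← Finset.sum_mul, ← map_sum, ← Finset.mul_sum]
  have e : ∑ i, ∑ j, ξ j i * kd N i j = ξ.trace := by
    simp [kd, Matrix.one_apply, Matrix.trace]
  rw [e, Matrix.sub_apply, Matrix.smul_apply, Algebra.smul_def]
  congr 1
  · simp [Matrix.mul_apply, cst, kd, Matrix.one_apply, apply_ite (algebraMap ℂ (CotSL N)),
      mul_comm]
  · congr 2; ring

theorem pb_ell_ell (ξ η : Matrix (Fin N) (Fin N) ℂ) :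
    PoissonAlg.pb (ell ξ) (ell η) = ell (ξ * η - η * ξ) := by
  have e : ∀ (D : Derivation ℂ (CotSL N) (CotSL N)) (M : Matrix (Fin N) (Fin N) (CotSL N)),
      D M.trace = (M.map D).trace := fun D M => by simp [Matrix.trace]
  have hη : ell η = (2 * N : ℂ) • (matX N * cst η).trace := rfl
  rw [← ham_apply, hη, Derivation.map_smul, e, map_derivation_mul, map_derivation_cst,
    ham_ell_X, mul_zero, add_zero, sub_mul, Matrix.trace_sub, mul_assoc (cst ξ),
    Matrix.trace_mul_comm (cst ξ), mul_assoc, mul_assoc, ← cst_mul, ← cst_mul, ← Matrix.trace_sub,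
    ← mul_sub, ell]
  have hs : cst (ξ * η - η * ξ) = cst (ξ * η) - cst (η * ξ) := by
    ext i j; simp only [cst, map_apply, Matrix.sub_apply, map_sub]
  rw [hs]

theorem pb_ell_g (ξ : Matrix (Fin N) (Fin N) ℂ) (hξ : ξ.trace = 0) (i j : Fin N) :
    PoissonAlg.pb (ell ξ) (matG N i j) = (matG N * cst ξ) i j := by
  have := congrFun (congrFun (ham_ell_G ξ) i) j
  rw [hξ] at this
  simpa [ham_apply] using this

theorem matX_eq_ell (i j : Fin N) :
    matX N i j = (1 / (2 * N) : ℂ) • ell (Matrix.single j i (1 : ℂ)) := by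
  have : (matX N * cst (Matrix.single j i (1 : ℂ))).trace = matX N i j := by
    simp [Matrix.trace, Matrix.mul_apply, cst, Matrix.single_apply, ite_and]
  rw [ell, this, smul_smul, one_div_mul_cancel (cN i), one_smul]

theorem map_rightTr_X (h : SpecialLinearGroup (Fin N) ℂ) :
    (matX N).map (rightTr h) = cst h⁻¹.1 * matX N * cst h.1 := by
  ext i j; simp only [map_apply, rightTr, cotLift_X]

theorem map_rightTr_G (h : SpecialLinearGroup (Fin N) ℂ) :
    (matG N).map (rightTr h) = matG N * cst h.1 := by
  ext i j; simp only [map_apply, rightTr, cotLift_G]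

theorem map_leftTr_X (h : SpecialLinearGroup (Fin N) ℂ) :
    (matX N).map (leftTr h) = matX N := by
  ext i j; simp only [map_apply, leftTr, cotLift_X]

theorem map_leftTr_G (h : SpecialLinearGroup (Fin N) ℂ) :
    (matG N).map (leftTr h) = cst h.1 * matG N := by
  ext i j; simp only [map_apply, leftTr, cotLift_G]

theorem map_cst {B : Type*} [CommRing B] [Algebra ℂ B] (φ : CotSL N →ₐ[ℂ] B)
    (ξ : Matrix (Fin N) (Fin N) ℂ) : (cst ξ).map φ = ξ.map (algebraMap ℂ B) := by
  ext i j; exact φ.commutes _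

theorem map_cst' (φ : CotSL N →ₐ[ℂ] CotSL N) (ξ : Matrix (Fin N) (Fin N) ℂ) :
    (cst ξ).map φ = cst ξ := map_cst φ ξ

theorem rightTr_ell (h : SpecialLinearGroup (Fin N) ℂ) (ξ : Matrix (Fin N) (Fin N) ℂ) :
    rightTr h (ell ξ) = ell (h.1 * ξ * h⁻¹.1) := by
  have e : ∀ M : Matrix (Fin N) (Fin N) (CotSL N),
      rightTr h M.trace = (M.map (rightTr h)).trace := fun M => by simp [Matrix.trace]
  rw [ell, ell, map_smul, e, Matrix.map_mul, map_rightTr_X, map_cst', mul_assoc, mul_assoc,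
    Matrix.trace_mul_comm, mul_assoc, mul_assoc, cst_mul, cst_mul, mul_assoc]

theorem leftTr_ell (h : SpecialLinearGroup (Fin N) ℂ) (ξ : Matrix (Fin N) (Fin N) ℂ) :
    leftTr h (ell ξ) = ell ξ := by
  have e : ∀ M : Matrix (Fin N) (Fin N) (CotSL N),
      leftTr h M.trace = (M.map (leftTr h)).trace := fun M => by simp [Matrix.trace]
  rw [ell, map_smul, e, Matrix.map_mul, map_leftTr_X, map_cst']

/-- An algebra endomorphism is Poisson as soon as it is so on coordinates. -/
theorem poisson_of_gens (φ : CotSL N →ₐ[ℂ] CotSL N)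
    (hX : ∀ ξ i j, φ (PoissonAlg.pb (ell ξ) (matX N i j)) =
      PoissonAlg.pb (φ (ell ξ)) (φ (matX N i j)))
    (hG : ∀ ξ i j, φ (PoissonAlg.pb (ell ξ) (matG N i j)) =
      PoissonAlg.pb (φ (ell ξ)) (φ (matG N i j)))
    (hGG : ∀ i j k l, PoissonAlg.pb (φ (matG N i j)) (φ (matG N k l)) = 0)
    (F H : CotSL N) : φ (PoissonAlg.pb F H) = PoissonAlg.pb (φ F) (φ H) := by
  have step : ∀ a : CotSL N,
      (∀ i j, φ (PoissonAlg.pb a (matX N i j)) = PoissonAlg.pb (φ a) (φ (matX N i j))) →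
      (∀ i j, φ (PoissonAlg.pb a (matG N i j)) = PoissonAlg.pb (φ a) (φ (matG N i j))) →
      ∀ H, φ (PoissonAlg.pb a H) = PoissonAlg.pb (φ a) (φ H) := by
    intro a h1 h2 H
    induction H using cot_induction with
    | hC r => rw [pb_algebraMap, AlgHom.commutes, pb_algebraMap, map_zero]
    | hX i j => exact h1 i j
    | hG i j => exact h2 i j
    | hadd b c hb hc => rw [PoissonAlg.pb_add, map_add, hb, hc, map_add, PoissonAlg.pb_add]
    | hmul b c hb hc =>
      rw [PoissonAlg.pb_mul, map_add, map_mul, map_mul, hb, hc, map_mul, PoissonAlg.pb_mul]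
  have swap : ∀ a b : CotSL N, φ (PoissonAlg.pb a b) = PoissonAlg.pb (φ a) (φ b) →
      φ (PoissonAlg.pb b a) = PoissonAlg.pb (φ b) (φ a) := by
    intro a b h
    rw [PoissonAlg.pb_skew b a, map_neg, h, ← PoissonAlg.pb_skew]
  have cX : ∀ i j H, φ (PoissonAlg.pb (matX N i j) H) = PoissonAlg.pb (φ (matX N i j)) (φ H) := by
    intro i j H
    rw [matX_eq_ell, pb_smul_left, map_smul, map_smul, pb_smul_left,
      step _ (hX _) (hG _)]
  have cG : ∀ i j H, φ (PoissonAlg.pb (matG N i j) H) = PoissonAlg.pb (φ (matG N i j)) (φ H) := by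
    intro i j H
    refine step _ (fun k l => swap _ _ (cX k l _)) (fun k l => ?_) H
    rw [pb_g_g, map_zero, hGG]
  refine step F (fun i j => swap _ _ (cX i j F)) (fun i j => swap _ _ (cG i j F)) H

theorem ham_G_G (i j : Fin N) : (matG N).map (ham (matG N i j)) = 0 := by
  ext k l; exact pb_g_g i j k l

theorem pb_lin_g_g (A B A' B' : Matrix (Fin N) (Fin N) ℂ) (i j k l : Fin N) :
    PoissonAlg.pb ((cst A * matG N * cst B) i j) ((cst A' * matG N * cst B') k l) = 0 := by
  have h1 : ∀ i j k l, PoissonAlg.pb (matG N i j) ((cst A' * matG N * cst B') k l) = 0 := by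
    intro i j k l
    have : (cst A' * matG N * cst B').map (ham (matG N i j)) = 0 := by
      rw [map_derivation_mul, map_derivation_mul, map_derivation_cst, map_derivation_cst, ham_G_G]
      simp
    exact congrFun (congrFun this k) l
  have h2 : (matG N).map (ham ((cst A' * matG N * cst B') k l)) = 0 := by
    ext i j
    rw [map_apply, ham_apply, PoissonAlg.pb_skew, h1]; simp
  have : (cst A * matG N * cst B).map (ham ((cst A' * matG N * cst B') k l)) = 0 := by
    rw [map_derivation_mul, map_derivation_mul, map_derivation_cst, map_derivation_cst, h2]
    simp
  rw [PoissonAlg.pb_skew, neg_eq_zero]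
  exact congrFun (congrFun this i) j

theorem rightTr_pb (h : SpecialLinearGroup (Fin N) ℂ) (F H : CotSL N) :
    rightTr h (PoissonAlg.pb F H) = PoissonAlg.pb (rightTr h F) (rightTr h H) := by
  refine poisson_of_gens _ (fun ξ i j => ?_) (fun ξ i j => ?_) (fun i j k l => ?_) F H
  · have e : ((matX N).map (ham (ell ξ))).map (rightTr h)
        = ((matX N).map (rightTr h)).map (ham (rightTr h (ell ξ))) := by
      rw [rightTr_ell, map_rightTr_X, ham_ell_X, map_derivation_mul, map_derivation_mul,
        map_derivation_cst, map_derivation_cst, ham_ell_X]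
      have hs : ∀ M M' : Matrix (Fin N) (Fin N) (CotSL N),
        (M - M').map (rightTr h) = M.map (rightTr h) - M'.map (rightTr h) := fun M M' => by
          ext; simp
      rw [hs, Matrix.map_mul, Matrix.map_mul, map_rightTr_X, map_cst']
      simp only [zero_mul, zero_add, mul_zero, add_zero, cst_mul, mul_sub, sub_mul, mul_assoc,
        cst_inv_mul, mul_one]
      simp only [← mul_assoc, cst_inv_mul, one_mul]
    exact congrFun (congrFun e i) j
  · have e : ((matG N).map (ham (ell ξ))).map (rightTr h)
        = ((matG N).map (rightTr h)).map (ham (rightTr h (ell ξ))) := by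
      have ht : (h.1 * ξ * h⁻¹.1).trace = ξ.trace := by
        rw [Matrix.trace_mul_comm, ← mul_assoc, val_inv_mul, one_mul]
      rw [rightTr_ell, map_rightTr_G, ham_ell_G, map_derivation_mul,
        map_derivation_cst, ham_ell_G, ht]
      have hs : ∀ (r : ℂ) (M M' : Matrix (Fin N) (Fin N) (CotSL N)),
        (M - r • M').map (rightTr h) = M.map (rightTr h) - r • M'.map (rightTr h) :=
          fun r M M' => by ext; simp
      rw [hs, Matrix.map_mul, map_rightTr_G, map_cst']
      simp only [mul_zero, add_zero, cst_mul, sub_mul, mul_assoc,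
        cst_inv_mul, mul_one, Matrix.smul_mul]
    exact congrFun (congrFun e i) j
  · have e : ∀ i j, rightTr h (matG N i j) = (cst (1 : Matrix (Fin N) (Fin N) ℂ) * matG N * cst h.1) i j := by
      intro i j
      rw [cst_one, one_mul]
      exact congrFun (congrFun (map_rightTr_G h) i) j
    rw [e, e, pb_lin_g_g]

theorem leftTr_pb (h : SpecialLinearGroup (Fin N) ℂ) (F H : CotSL N) :
    leftTr h (PoissonAlg.pb F H) = PoissonAlg.pb (leftTr h F) (leftTr h H) := by
  refine poisson_of_gens _ (fun ξ i j => ?_) (fun ξ i j => ?_) (fun i j k l => ?_) F H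
  · have e : ((matX N).map (ham (ell ξ))).map (leftTr h)
        = ((matX N).map (leftTr h)).map (ham (leftTr h (ell ξ))) := by
      rw [leftTr_ell, map_leftTr_X, ham_ell_X]
      have hs : ∀ M M' : Matrix (Fin N) (Fin N) (CotSL N),
        (M - M').map (leftTr h) = M.map (leftTr h) - M'.map (leftTr h) := fun M M' => by
          ext; simp
      rw [hs, Matrix.map_mul, Matrix.map_mul, map_leftTr_X, map_cst']
    exact congrFun (congrFun e i) j
  · have e : ((matG N).map (ham (ell ξ))).map (leftTr h)
        = ((matG N).map (leftTr h)).map (ham (leftTr h (ell ξ))) := by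
      rw [leftTr_ell, map_leftTr_G, ham_ell_G, map_derivation_mul, map_derivation_cst, ham_ell_G]
      have hs : ∀ (r : ℂ) (M M' : Matrix (Fin N) (Fin N) (CotSL N)),
        (M - r • M').map (leftTr h) = M.map (leftTr h) - r • M'.map (leftTr h) :=
          fun r M M' => by ext; simp
      rw [hs, Matrix.map_mul, map_leftTr_G, map_cst']
      simp only [zero_mul, zero_add, mul_sub, mul_assoc, Matrix.mul_smul]
    exact congrFun (congrFun e i) j
  · have e : ∀ i j, leftTr h (matG N i j) = (cst h.1 * matG N * cst (1 : Matrix (Fin N) (Fin N) ℂ)) i j := by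
      intro i j
      rw [cst_one, mul_one]
      exact congrFun (congrFun (map_leftTr_G h) i) j
    rw [e, e, pb_lin_g_g]

end Cotangent

/-! ### Two-sided Kostant–Whittaker reduction -/

section Reduction

variable (N : ℕ)

/-- The sum of the negative simple root vectors, `f = ∑ E_{i+1,i}`. -/
def lowF : Matrix (Fin N) (Fin N) ℂ := .of fun i j => if (i : ℕ) = j + 1 then 1 else 0

/-- The moment map of the translations `g ↦ g h`, as a matrix of functions: `x`. -/
abbrev momX : Matrix (Fin N) (Fin N) (CotSL N) := matX N

/-- The moment map of the translations `g ↦ h g`, as a matrix of functions: `Ad_g x = g x g⁻¹`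
(recall `det g = 1`, so that `g⁻¹` is the adjugate). -/
def momY : Matrix (Fin N) (Fin N) (CotSL N) := matG N * matX N * (matG N).adjugate

/-- The equations saying that both moment maps lie in `f + 𝔟`, where `𝔟` is the upper triangular
Borel subalgebra; as `𝔟` is the annihilator of `𝔫` under the Killing form, this says that both
moment maps restrict on `𝔫` to the character `χ = κ(f, ·)`. -/
def kwRel : Set (CotSL N) :=
  {z | ∃ i j : Fin N, j < i ∧ (z = momX N i j - algebraMap ℂ _ (lowF N i j) ∨
    z = momY N i j - algebraMap ℂ _ (lowF N i j))}

/-- The ideal of the common level set `μ_L⁻¹(χ) ∩ μ_R⁻¹(χ)` in `T^*SL_N`. -/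
def kwIdeal : Ideal (CotSL N) := Ideal.span (kwRel N)

variable {N}

/-- Membership in the group `N` of upper unitriangular matrices. -/
def IsUpperUnipotent (h : SpecialLinearGroup (Fin N) ℂ) : Prop :=
  ∀ i, h.1 i i = 1 ∧ ∀ j < i, h.1 i j = 0

variable (N) in
/-- The functions on `T^*SL_N` whose restriction to the level set is invariant under left and right
translations by upper unitriangular matrices. -/
def kwInv : Subalgebra ℂ (CotSL N) where
  carrier := {F | ∀ h : SpecialLinearGroup (Fin N) ℂ, IsUpperUnipotent h →
    rightTr h F - F ∈ kwIdeal N ∧ leftTr h F - F ∈ kwIdeal N}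
  mul_mem' := by
    intro a b ha hb h hh
    have key : ∀ φ : CotSL N →ₐ[ℂ] CotSL N, φ a - a ∈ kwIdeal N → φ b - b ∈ kwIdeal N →
        φ (a * b) - a * b ∈ kwIdeal N := by
      intro φ h1 h2
      have : φ (a * b) - a * b = φ a * (φ b - b) + b * (φ a - a) := by rw [map_mul]; ring
      rw [this]
      exact Ideal.add_mem _ (Ideal.mul_mem_left _ _ h2) (Ideal.mul_mem_left _ _ h1)
    exact ⟨key _ (ha h hh).1 (hb h hh).1, key _ (ha h hh).2 (hb h hh).2⟩
  add_mem' := by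
    intro a b ha hb h hh
    have key : ∀ φ : CotSL N →ₐ[ℂ] CotSL N, φ a - a ∈ kwIdeal N → φ b - b ∈ kwIdeal N →
        φ (a + b) - (a + b) ∈ kwIdeal N := by
      intro φ h1 h2
      have : φ (a + b) - (a + b) = (φ b - b) + (φ a - a) := by rw [map_add]; ring
      rw [this]
      exact Ideal.add_mem _ h2 h1
    exact ⟨key _ (ha h hh).1 (hb h hh).1, key _ (ha h hh).2 (hb h hh).2⟩
  algebraMap_mem' := by
    intro r h _
    rw [AlgHom.commutes, AlgHom.commutes, sub_self]
    exact ⟨Ideal.zero_mem _, Ideal.zero_mem _⟩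

/-- If a polynomial curve stays in a coset of an ideal, its velocity lies in the ideal. -/
theorem coeff_one_mem (I : Ideal (CotSL N)) (p : Polynomial (CotSL N)) (F : CotSL N)
    (h : ∀ t : ℂ, p.eval (algebraMap ℂ _ t) - F ∈ I) : p.coeff 1 ∈ I := by
  by_contra hp
  obtain ⟨φ, h1, h2⟩ := Submodule.exists_le_ker_of_notMem
    (p := I.restrictScalars ℂ) (v := p.coeff 1) hp
  let q : Polynomial ℂ := ∑ k ∈ Finset.range (p.natDegree + 2),
    Polynomial.monomial k (φ (p.coeff k))
  have hq : ∀ t, q.eval t = φ F := by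
    intro t
    have : φ (p.eval (algebraMap ℂ _ t) - F) = 0 := h2 (h t)
    rw [map_sub, sub_eq_zero] at this
    rw [← this, Polynomial.eval_eq_sum_range' (p := p) (n := p.natDegree + 2) (by omega)]
    simp only [q, Polynomial.eval_finsetSum, Polynomial.eval_monomial, map_sum]
    refine Finset.sum_congr rfl fun k _ => ?_
    rw [← map_pow, mul_comm (p.coeff k), ← Algebra.smul_def, map_smul, smul_eq_mul, mul_comm]
  have hq' : q = Polynomial.C (φ F) := Polynomial.funext fun t => by rw [hq, Polynomial.eval_C]
  have hc : q.coeff 1 = φ (p.coeff 1) := by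
    simp only [q, Polynomial.finsetSum_coeff, Polynomial.coeff_monomial]
    rw [Finset.sum_ite_eq' (Finset.range (p.natDegree + 2)) 1]
    simp
  rw [hq'] at hc
  apply h1
  rw [← hc]
  simp

/-- A one-parameter family of translations whose velocity is the derivation `D`. -/
theorem velocity_mem (Φ : CotSL N →ₐ[ℂ] Polynomial (CotSL N)) (D : Derivation ℂ (CotSL N) (CotSL N))
    (hX0 : ∀ i j, (Φ (matX N i j)).coeff 0 = matX N i j)
    (hG0 : ∀ i j, (Φ (matG N i j)).coeff 0 = matG N i j)
    (hX1 : ∀ i j, (Φ (matX N i j)).coeff 1 = D (matX N i j))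
    (hG1 : ∀ i j, (Φ (matG N i j)).coeff 1 = D (matG N i j))
    (ρ : ℂ → CotSL N →ₐ[ℂ] CotSL N)
    (hX : ∀ t i j, (Φ (matX N i j)).eval (algebraMap ℂ _ t) = ρ t (matX N i j))
    (hG : ∀ t i j, (Φ (matG N i j)).eval (algebraMap ℂ _ t) = ρ t (matG N i j))
    (I : Ideal (CotSL N)) (F : CotSL N) (h : ∀ t, ρ t F - F ∈ I) : D F ∈ I := by
  have h1 : ∀ F, (Φ F).coeff 0 = F ∧ (Φ F).coeff 1 = D F := by
    intro F
    induction F using cot_induction with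
    | hC r =>
      rw [AlgHom.commutes, Derivation.map_algebraMap, Polynomial.algebraMap_apply]
      simp [Polynomial.coeff_C]
    | hX i j => exact ⟨hX0 i j, hX1 i j⟩
    | hG i j => exact ⟨hG0 i j, hG1 i j⟩
    | hadd a b ha hb =>
      simp only [map_add, Polynomial.coeff_add, ha.1, ha.2, hb.1, hb.2, and_self]
    | hmul a b ha hb =>
      rw [map_mul, Polynomial.mul_coeff_zero, Polynomial.mul_coeff_one, ha.1, ha.2, hb.1, hb.2,
        Derivation.leibniz, smul_eq_mul, smul_eq_mul]
      exact ⟨rfl, by ring⟩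
  have h2 : ∀ t F, (Φ F).eval (algebraMap ℂ _ t) = ρ t F := by
    intro t F
    induction F using cot_induction with
    | hC r =>
      rw [AlgHom.commutes, AlgHom.commutes, Polynomial.algebraMap_apply]
      simp
    | hX i j => exact hX t i j
    | hG i j => exact hG t i j
    | hadd a b ha hb => rw [map_add, Polynomial.eval_add, ha, hb, map_add]
    | hmul a b ha hb => rw [map_mul, Polynomial.eval_mul, ha, hb, map_mul]
  rw [← (h1 F).2]
  refine coeff_one_mem I _ F fun t => ?_
  rw [h2]
  exact h t

/-- The elementary matrix `1 + t E_{ij}`. -/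
def elem (i j : Fin N) (hij : i ≠ j) (t : ℂ) : SpecialLinearGroup (Fin N) ℂ :=
  ⟨transvection i j t, det_transvection_of_ne _ _ hij t⟩

theorem elem_inv (i j : Fin N) (hij : i ≠ j) (t : ℂ) :
    (elem i j hij t)⁻¹ = elem i j hij (-t) := by
  rw [inv_eq_iff_mul_eq_one]
  apply Subtype.ext
  change transvection i j t * transvection i j (-t) = 1
  rw [transvection_mul_transvection_same _ _ hij, add_neg_cancel, transvection_zero]

theorem elem_unipotent (i j : Fin N) (hij : i < j) (t : ℂ) :
    IsUpperUnipotent (elem i j hij.ne t) := by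
  intro k
  refine ⟨?_, fun l hl => ?_⟩
  · change transvection i j t k k = 1
    simp only [transvection, Matrix.add_apply, Matrix.one_apply_eq, Matrix.single_apply]
    rw [if_neg, add_zero]
    rintro ⟨rfl, rfl⟩; exact lt_irrefl _ hij
  · change transvection i j t k l = 0
    simp only [transvection, Matrix.add_apply, Matrix.one_apply_ne hl.ne', Matrix.single_apply]
    rw [if_neg, add_zero]
    rintro ⟨rfl, rfl⟩; exact lt_asymm hij hl

theorem ham_matX (i j : Fin N) :
    ham (matX N i j) = (1 / (2 * N) : ℂ) • ham (ell (Matrix.single j i (1 : ℂ))) := by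
  ext F
  rw [Derivation.smul_apply, ham_apply, ham_apply, ← pb_smul_left, ← matX_eq_ell]

section Curves

open Polynomial (C X eval)

theorem eval_transvection (i j : Fin N) (t : ℂ) (s : Polynomial (CotSL N)) :
    (transvection i j s).map (eval (algebraMap ℂ (CotSL N) t)) =
      transvection i j (s.eval (algebraMap ℂ (CotSL N) t)) := by
  ext k l
  simp only [transvection, map_apply, Matrix.add_apply, Polynomial.eval_add, Matrix.one_apply,
    Matrix.single_apply]
  split_ifs <;> simp

theorem cst_elem (i j : Fin N) (hij : i ≠ j) (t : ℂ) :
    cst (elem i j hij t).1 = transvection i j (algebraMap ℂ (CotSL N) t) := by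
  ext k l
  simp only [cst, elem, transvection, map_apply, Matrix.add_apply, map_add, Matrix.one_apply,
    Matrix.single_apply]
  split_ifs <;> simp

theorem eval_map_C (t : ℂ) (M : Matrix (Fin N) (Fin N) (CotSL N)) :
    (M.map C).map (eval (algebraMap ℂ (CotSL N) t)) = M := by
  ext k l; simp

theorem eval_map_mul (t : ℂ) (M M' : Matrix (Fin N) (Fin N) (Polynomial (CotSL N))) :
    (M * M').map (eval (algebraMap ℂ (CotSL N) t)) =
      M.map (eval (algebraMap ℂ (CotSL N) t)) * M'.map (eval (algebraMap ℂ (CotSL N) t)) :=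
  Matrix.map_mul (f := Polynomial.evalRingHom (algebraMap ℂ (CotSL N) t))

theorem transvection_eq (i j : Fin N) (c : Polynomial (CotSL N)) :
    transvection i j c = 1 + c • (cst (Matrix.single i j (1 : ℂ))).map C := by
  ext k l
  simp only [transvection, Matrix.add_apply, Matrix.single_apply, cst, Matrix.smul_apply,
    map_apply, smul_eq_mul]
  split_ifs <;> simp

theorem det_map_C (M : Matrix (Fin N) (Fin N) (CotSL N)) : (M.map C).det = C M.det := by
  rw [← RingHom.mapMatrix_apply, ← RingHom.map_det]

theorem trace_map_C (M : Matrix (Fin N) (Fin N) (CotSL N)) : (M.map C).trace = C M.trace := by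
  simp [Matrix.trace]

theorem trace_single (i j : Fin N) (hij : i ≠ j) : (Matrix.single i j (1 : ℂ)).trace = 0 := by
  simp [Matrix.trace, hij]

theorem pb_matX_mem {I : Ideal (CotSL N)} {F : CotSL N} {i j : Fin N} (hij : j < i)
    (hF : ∀ t, rightTr (elem j i hij.ne t) F - F ∈ I) : PoissonAlg.pb (matX N i j) F ∈ I := by
  have hinv : transvection j i (X : Polynomial (CotSL N)) * transvection j i (-X) = 1 := by
    rw [transvection_mul_transvection_same _ _ hij.ne, add_neg_cancel, transvection_zero]
  let x' := transvection j i (-X) * (matX N).map C * transvection j i (X : Polynomial (CotSL N))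
  let g' := (matG N).map C * transvection j i (X : Polynomial (CotSL N))
  have hx' : x'.trace = 0 := by
    rw [Matrix.trace_mul_comm, ← mul_assoc, hinv, one_mul, trace_map_C, trace_matX, map_zero]
  have hg' : g'.det = 1 := by
    rw [Matrix.det_mul, det_transvection_of_ne _ _ hij.ne, det_map_C, det_matG, map_one, one_mul]
  set E : Matrix (Fin N) (Fin N) (CotSL N) := cst (Matrix.single j i (1 : ℂ)) with hE
  have hgx : g' = (matG N).map C + (X : Polynomial (CotSL N)) • (matG N * E).map C := by
    simp only [g', transvection_eq, ← hE, mul_add, mul_one, Matrix.mul_smul, Matrix.map_mul]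
  have hxx : x' = (matX N).map C + (X : Polynomial (CotSL N)) • (matX N * E - E * matX N).map C
      - (X ^ 2 : Polynomial (CotSL N)) • (E * matX N * E).map C := by
    have : (matX N * E - E * matX N).map C = (matX N * E).map C - (E * matX N).map C := by
      ext1; simp only [map_apply, Matrix.sub_apply, map_sub]
    simp only [x', transvection_eq, ← hE, this, mul_add, mul_one, add_mul, one_mul,
      Matrix.mul_smul, Matrix.smul_mul, Matrix.map_mul, neg_smul, smul_neg, smul_smul,
      Matrix.neg_mul, ← pow_two, smul_sub]
    abel
  have := velocity_mem (cotLift x' g' hx' hg') (ham (ell (Matrix.single j i (1 : ℂ))))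
    (fun k l => by
      rw [cotLift_X, hxx]
      simp only [Matrix.sub_apply, Matrix.add_apply, Matrix.smul_apply, map_apply, smul_eq_mul,
        pow_two, Polynomial.coeff_sub, Polynomial.coeff_add, Polynomial.mul_coeff_zero,
        Polynomial.coeff_C_zero, Polynomial.coeff_X_zero, zero_mul, add_zero, sub_zero])
    (fun k l => by
      rw [cotLift_G, hgx]
      simp only [Matrix.add_apply, Matrix.smul_apply, map_apply, smul_eq_mul,
        Polynomial.coeff_add, Polynomial.mul_coeff_zero,
        Polynomial.coeff_C_zero, Polynomial.coeff_X_zero, zero_mul, add_zero])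
    (fun k l => by
      rw [cotLift_X, hxx, ← map_apply (M := matX N) (f := ham _), ham_ell_X]
      simp only [Matrix.sub_apply, Matrix.add_apply, Matrix.smul_apply, map_apply, smul_eq_mul,
        pow_two, Polynomial.coeff_sub, Polynomial.coeff_add, Polynomial.mul_coeff_zero,
        Polynomial.mul_coeff_one, Polynomial.coeff_C_zero, Polynomial.coeff_X_zero,
        Polynomial.coeff_X_one, Polynomial.coeff_C_succ, zero_mul, mul_zero, one_mul, add_zero,
        zero_add, sub_zero, ← hE])
    (fun k l => by
      rw [cotLift_G, hgx, ← map_apply (M := matG N) (f := ham _), ham_ell_G,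
        trace_single _ _ hij.ne]
      simp only [Matrix.sub_apply, Matrix.add_apply, Matrix.smul_apply, map_apply, smul_eq_mul,
        Polynomial.coeff_add, Polynomial.mul_coeff_one, Polynomial.coeff_C_zero,
        Polynomial.coeff_X_zero, Polynomial.coeff_X_one, Polynomial.coeff_C_succ, zero_mul,
        one_mul, zero_add, zero_div, zero_smul, Matrix.zero_apply, sub_zero, ← hE])
    (fun t => rightTr (elem j i hij.ne t))
    (fun t k l => by
      rw [cotLift_X]
      have e : x'.map (eval (algebraMap ℂ (CotSL N) t)) =
          (matX N).map (rightTr (elem j i hij.ne t)) := by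
        rw [map_rightTr_X, elem_inv, cst_elem, cst_elem, eval_map_mul, eval_map_mul,
          eval_transvection, eval_transvection, eval_map_C]
        simp
      exact congrFun (congrFun e k) l)
    (fun t k l => by
      rw [cotLift_G]
      have e : g'.map (eval (algebraMap ℂ (CotSL N) t)) =
          (matG N).map (rightTr (elem j i hij.ne t)) := by
        rw [map_rightTr_G, cst_elem, eval_map_mul, eval_transvection, eval_map_C]
        simp
      exact congrFun (congrFun e k) l)
    I F hF
  rw [← ham_apply, ham_matX, Derivation.smul_apply]
  exact Submodule.smul_of_tower_mem I _ this

theorem G_mul_adj : matG N * (matG N).adjugate = 1 := by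
  rw [Matrix.mul_adjugate, det_matG, one_smul]

theorem adj_mul_G : (matG N).adjugate * matG N = 1 := by
  rw [Matrix.adjugate_mul, det_matG, one_smul]

theorem map_adj (D : Derivation ℂ (CotSL N) (CotSL N)) :
    (matG N).adjugate.map D = - ((matG N).adjugate * (matG N).map D * (matG N).adjugate) := by
  have h1 : (matG N).map D * (matG N).adjugate + matG N * (matG N).adjugate.map D = 0 := by
    rw [← map_derivation_mul, G_mul_adj, ← cst_one, map_derivation_cst]
  have h2 := congrArg (fun M => (matG N).adjugate * M) h1
  simp only [mul_add, mul_zero, ← mul_assoc, adj_mul_G, one_mul] at h2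
  exact eq_neg_of_add_eq_zero_right h2

theorem ham_ell_momY (ξ : Matrix (Fin N) (Fin N) ℂ) : (momY N).map (ham (ell ξ)) = 0 := by
  have hG : (matG N).map (ham (ell ξ)) =
      matG N * (cst ξ - (ξ.trace / N) • (1 : Matrix (Fin N) (Fin N) (CotSL N))) := by
    rw [ham_ell_G, mul_sub, Matrix.mul_smul, mul_one]
  have hX : (matX N).map (ham (ell ξ)) =
      matX N * (cst ξ - (ξ.trace / N) • (1 : Matrix (Fin N) (Fin N) (CotSL N))) -
        (cst ξ - (ξ.trace / N) • (1 : Matrix (Fin N) (Fin N) (CotSL N))) * matX N := by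
    rw [ham_ell_X, mul_sub, Matrix.mul_smul, mul_one, sub_mul, Matrix.smul_mul, one_mul]
    abel
  generalize (cst ξ - (ξ.trace / N) • (1 : Matrix (Fin N) (Fin N) (CotSL N))) = c at hG hX
  rw [momY, map_derivation_mul, map_derivation_mul, map_adj, hG, hX, ← mul_assoc, adj_mul_G,
    one_mul]
  noncomm_ring

theorem pb_momY_X (i j k l : Fin N) : PoissonAlg.pb (momY N i j) (matX N k l) = 0 := by
  rw [PoissonAlg.pb_skew, matX_eq_ell, pb_smul_left, ← ham_apply,
    ← map_apply (M := momY N) (f := ham _), ham_ell_momY]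
  simp

theorem pb_momY_G (i j k l : Fin N) (hij : i ≠ j) : PoissonAlg.pb (momY N i j) (matG N k l) =
    (1 / (2 * N) : ℂ) • (cst (Matrix.single j i (1 : ℂ)) * matG N) k l := by
  have h1 : (momY N).map (ham (matG N k l)) =
      matG N * (matX N).map (ham (matG N k l)) * (matG N).adjugate := by
    rw [momY, map_derivation_mul, map_derivation_mul, map_adj, ham_G_G]
    simp
  have h2 : ∀ a b, (matX N).map (ham (matG N k l)) a b = - (algebraMap ℂ _ (1 / (2 * N) : ℂ) *
      (algebraMap ℂ _ (kd N a l) * matG N k b -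
        algebraMap ℂ _ (1 / N : ℂ) * algebraMap ℂ _ (kd N a b) * matG N k l)) := by
    intro a b
    rw [map_apply, ham_apply, PoissonAlg.pb_skew, pb_matX_matG]
  have h3 : (matX N).map (ham (matG N k l)) = - ((1 / (2 * N) : ℂ) •
      (Matrix.vecMulVec (fun a => algebraMap ℂ _ (kd N a l)) (fun b => matG N k b) -
        (algebraMap ℂ _ (1 / N : ℂ) * matG N k l) • (1 : Matrix (Fin N) (Fin N) (CotSL N)))) := by
    ext a b
    rw [h2, Matrix.neg_apply, Matrix.smul_apply, Matrix.sub_apply, Matrix.smul_apply,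
      Matrix.vecMulVec_apply, Algebra.smul_def]
    congr 3
    simp only [kd, Matrix.one_apply, smul_eq_mul]
    split_ifs <;> simp
  have h4 : (matG N) *ᵥ (fun a => algebraMap ℂ _ (kd N a l)) = fun a => matG N a l := by
    ext a
    simp [Matrix.mulVec, dotProduct, kd, Matrix.one_apply, apply_ite (algebraMap ℂ (CotSL N))]
  have h5 : (fun b => matG N k b) ᵥ* (matG N).adjugate =
      fun b => (1 : Matrix (Fin N) (Fin N) (CotSL N)) k b := by
    ext b
    rw [← G_mul_adj]; rfl
  rw [PoissonAlg.pb_skew, ← ham_apply, ← map_apply (M := momY N) (f := ham _), h1, h3]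
  simp only [mul_neg, neg_mul, Matrix.mul_smul, Matrix.smul_mul, mul_sub, sub_mul, mul_one,
    G_mul_adj, Matrix.mul_vecMulVec, Matrix.vecMulVec_mul, h4, h5, Matrix.neg_apply, neg_neg,
    Matrix.smul_apply, Matrix.sub_apply, Matrix.vecMulVec_apply, Matrix.one_apply_ne hij,
    smul_zero, sub_zero]
  congr 1
  rw [Matrix.mul_apply]
  simp [cst, Matrix.single_apply, Matrix.one_apply, ite_and, apply_ite (algebraMap ℂ (CotSL N)),
    eq_comm]

theorem pb_momY_mem {I : Ideal (CotSL N)} {F : CotSL N} {i j : Fin N} (hij : j < i)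
    (hF : ∀ t, leftTr (elem j i hij.ne t) F - F ∈ I) : PoissonAlg.pb (momY N i j) F ∈ I := by
  let x' := (matX N).map (C : CotSL N → Polynomial (CotSL N))
  let g' := transvection j i (X : Polynomial (CotSL N)) * (matG N).map C
  have hx' : x'.trace = 0 := by rw [trace_map_C, trace_matX, map_zero]
  have hg' : g'.det = 1 := by
    rw [Matrix.det_mul, det_transvection_of_ne _ _ hij.ne, det_map_C, det_matG, map_one, one_mul]
  set E : Matrix (Fin N) (Fin N) (CotSL N) := cst (Matrix.single j i (1 : ℂ)) with hE
  have hgx : g' = (matG N).map C + (X : Polynomial (CotSL N)) • (E * matG N).map C := by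
    simp only [g', transvection_eq, ← hE, add_mul, one_mul, Matrix.smul_mul, Matrix.map_mul]
  have := velocity_mem (cotLift x' g' hx' hg') ((2 * N : ℂ) • ham (momY N i j))
    (fun k l => by
      rw [cotLift_X]
      simp only [x', map_apply, Polynomial.coeff_C_zero])
    (fun k l => by
      rw [cotLift_G, hgx]
      simp only [Matrix.add_apply, Matrix.smul_apply, map_apply, smul_eq_mul,
        Polynomial.coeff_add, Polynomial.mul_coeff_zero,
        Polynomial.coeff_C_zero, Polynomial.coeff_X_zero, zero_mul, add_zero])
    (fun k l => by
      rw [cotLift_X, Derivation.smul_apply, ham_apply, pb_momY_X, smul_zero]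
      simp only [x', map_apply, Polynomial.coeff_C_succ])
    (fun k l => by
      rw [cotLift_G, hgx, Derivation.smul_apply, ham_apply, pb_momY_G _ _ _ _ hij.ne', smul_smul,
        mul_one_div_cancel (cN i), one_smul]
      simp only [Matrix.add_apply, Matrix.smul_apply, map_apply, smul_eq_mul,
        Polynomial.coeff_add, Polynomial.mul_coeff_one, Polynomial.coeff_C_zero,
        Polynomial.coeff_X_zero, Polynomial.coeff_X_one, Polynomial.coeff_C_succ, zero_mul,
        one_mul, zero_add, ← hE])
    (fun t => leftTr (elem j i hij.ne t))
    (fun t k l => by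
      rw [cotLift_X]
      have e : x'.map (eval (algebraMap ℂ (CotSL N) t)) =
          (matX N).map (leftTr (elem j i hij.ne t)) := by
        rw [map_leftTr_X, eval_map_C]
      exact congrFun (congrFun e k) l)
    (fun t k l => by
      rw [cotLift_G]
      have e : g'.map (eval (algebraMap ℂ (CotSL N) t)) =
          (matG N).map (leftTr (elem j i hij.ne t)) := by
        rw [map_leftTr_G, cst_elem, eval_map_mul, eval_transvection, eval_map_C]
        simp
      exact congrFun (congrFun e k) l)
    I F hF
  have h2 : PoissonAlg.pb (momY N i j) F =
      (1 / (2 * N) : ℂ) • ((2 * N : ℂ) • ham (momY N i j)) F := by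
    rw [Derivation.smul_apply, smul_smul, one_div_mul_cancel (cN i), one_smul, ham_apply]
  rw [h2]
  exact Submodule.smul_of_tower_mem I _ this

end Curves

theorem pb_momY_momY (i j k l : Fin N) (hij : i ≠ j) : PoissonAlg.pb (momY N i j) (momY N k l) =
    (1 / (2 * N) : ℂ) • (cst (Matrix.single j i (1 : ℂ)) * momY N -
      momY N * cst (Matrix.single j i (1 : ℂ))) k l := by
  have hX : (matX N).map (ham (momY N i j)) = 0 := by
    ext k l; exact pb_momY_X i j k l
  have hG : (matG N).map (ham (momY N i j)) =
      (1 / (2 * N) : ℂ) • (cst (Matrix.single j i (1 : ℂ)) * matG N) := by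
    ext k l; exact pb_momY_G i j k l hij
  have : (momY N).map (ham (momY N i j)) = (1 / (2 * N) : ℂ) •
      (cst (Matrix.single j i (1 : ℂ)) * momY N - momY N * cst (Matrix.single j i (1 : ℂ))) := by
    generalize cst (Matrix.single j i (1 : ℂ)) = E at hG
    generalize ham (momY N i j) = D at hG hX
    rw [momY, map_derivation_mul, map_derivation_mul, map_adj, hG, hX]
    simp only [mul_zero, add_zero, Matrix.smul_mul, Matrix.mul_smul, mul_neg, smul_sub]
    have h1 : matG N * matX N * ((matG N).adjugate * (E * matG N) * (matG N).adjugate) =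
        momY N * E := by
      rw [mul_assoc (matG N).adjugate, mul_assoc E, G_mul_adj, mul_one, ← mul_assoc, momY]
    rw [h1, momY]
    simp only [mul_assoc, sub_eq_add_neg]
  exact congrFun (congrFun this k) l

theorem momX_rel_mem {i j : Fin N} (h : j < i) :
    matX N i j - algebraMap ℂ _ (lowF N i j) ∈ kwIdeal N :=
  Ideal.subset_span ⟨i, j, h, Or.inl rfl⟩

theorem momY_rel_mem {i j : Fin N} (h : j < i) :
    momY N i j - algebraMap ℂ _ (lowF N i j) ∈ kwIdeal N :=
  Ideal.subset_span ⟨i, j, h, Or.inr rfl⟩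

theorem lowF_eq_zero {i j k : Fin N} (h : j < i) (h' : k < j) : lowF N i k = 0 := by
  have h1 : (j : ℕ) < i := h
  have h2 : (k : ℕ) < j := h'
  simp only [lowF, of_apply]
  rw [if_neg]
  omega

/-- The moment map equations are in involution modulo themselves. -/
theorem kwRel_involutive {a b : CotSL N} (ha : a ∈ kwRel N) (hb : b ∈ kwRel N) :
    PoissonAlg.pb a b ∈ kwIdeal N := by
  have hx : ∀ {i j k : Fin N}, j < i → k < j → matX N i k ∈ kwIdeal N := by
    intro i j k h h'
    have := momX_rel_mem (h'.trans h)
    rwa [lowF_eq_zero h h', map_zero, sub_zero] at this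
  have hy : ∀ {i j k : Fin N}, j < i → k < j → momY N i k ∈ kwIdeal N := by
    intro i j k h h'
    have := momY_rel_mem (h'.trans h)
    rwa [lowF_eq_zero h h', map_zero, sub_zero] at this
  obtain ⟨i, j, hij, rfl | rfl⟩ := ha <;> obtain ⟨k, l, hkl, rfl | rfl⟩ := hb <;>
    rw [pb_sub, pb_algebraMap, sub_zero, pb_sub_left, pb_algebraMap_left, sub_zero]
  · rw [pb_matX_matX]
    refine Ideal.mul_mem_left _ _ (Ideal.sub_mem _ ?_ ?_)
    · rcases eq_or_ne i l with rfl | h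
      · exact Ideal.mul_mem_left _ _ (hx hkl hij)
      · simp [kd, Matrix.one_apply_ne h]
    · rcases eq_or_ne k j with rfl | h
      · exact Ideal.mul_mem_left _ _ (hx hij hkl)
      · simp [kd, Matrix.one_apply_ne h]
  · rw [PoissonAlg.pb_skew, pb_momY_X, neg_zero]; exact Ideal.zero_mem _
  · rw [pb_momY_X]; exact Ideal.zero_mem _
  · rw [pb_momY_momY _ _ _ _ hij.ne']
    refine Submodule.smul_of_tower_mem _ _ ?_
    have h1 : (cst (Matrix.single j i (1 : ℂ)) * momY N) k l =
        if j = k then momY N i l else 0 := by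
      rw [Matrix.mul_apply]
      simp [cst, Matrix.single_apply, ite_and, apply_ite (algebraMap ℂ (CotSL N))]
    have h2 : (momY N * cst (Matrix.single j i (1 : ℂ))) k l =
        if i = l then momY N k j else 0 := by
      rw [Matrix.mul_apply]
      simp [cst, Matrix.single_apply, ite_and, apply_ite (algebraMap ℂ (CotSL N))]
    rw [Matrix.sub_apply, h1, h2]
    refine Ideal.sub_mem _ ?_ ?_
    · split_ifs with h
      · subst h; exact hy hij hkl
      · exact Ideal.zero_mem _
    · split_ifs with h
      · subst h; exact hy hkl hij
      · exact Ideal.zero_mem _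

theorem kwIdeal_involutive {a b : CotSL N} (ha : a ∈ kwIdeal N) (hb : b ∈ kwIdeal N) :
    PoissonAlg.pb a b ∈ kwIdeal N := by
  refine pb_mem_span a (fun z hz => ?_) hb
  rw [PoissonAlg.pb_skew, ← mul_neg_one]
  exact Ideal.mul_mem_right _ _ (pb_mem_span z (fun w hw => kwRel_involutive hz hw) ha)

theorem kwInv_pb_ideal {a b : CotSL N} (ha : a ∈ kwInv N) (hb : b ∈ kwIdeal N) :
    PoissonAlg.pb a b ∈ kwIdeal N := by
  refine pb_mem_span a (fun z hz => ?_) hb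
  obtain ⟨i, j, hij, rfl | rfl⟩ := hz <;>
    rw [pb_sub, pb_algebraMap, sub_zero, PoissonAlg.pb_skew, ← mul_neg_one] <;>
    refine Ideal.mul_mem_right _ _ ?_
  · exact pb_matX_mem hij fun t => (ha _ (elem_unipotent j i hij t)).1
  · exact pb_momY_mem hij fun t => (ha _ (elem_unipotent j i hij t)).2

theorem kwInv_pb {a b : CotSL N} (ha : a ∈ kwInv N) (hb : b ∈ kwInv N) :
    PoissonAlg.pb a b ∈ kwInv N := by
  have key : ∀ φ : CotSL N →ₐ[ℂ] CotSL N,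
      φ (PoissonAlg.pb a b) = PoissonAlg.pb (φ a) (φ b) → φ a - a ∈ kwIdeal N →
      φ b - b ∈ kwIdeal N → φ (PoissonAlg.pb a b) - PoissonAlg.pb a b ∈ kwIdeal N := by
    intro φ h h1 h2
    have : φ (PoissonAlg.pb a b) - PoissonAlg.pb a b =
        PoissonAlg.pb (φ a - a) (φ b - b) + PoissonAlg.pb a (φ b - b)
          - PoissonAlg.pb b (φ a - a) := by
      rw [h, pb_sub, pb_sub, pb_sub, pb_sub_left, pb_sub_left, PoissonAlg.pb_skew b (φ a),
        PoissonAlg.pb_skew b a]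
      ring
    rw [this]
    exact Ideal.sub_mem _ (Ideal.add_mem _ (kwIdeal_involutive h1 h2) (kwInv_pb_ideal ha h2))
      (kwInv_pb_ideal hb h1)
  intro h hh
  exact ⟨key _ (rightTr_pb h a b) (ha h hh).1 (hb h hh).1,
    key _ (leftTr_pb h a b) (ha h hh).2 (hb h hh).2⟩

variable (N)

instance kwInvPoisson : PoissonAlg (kwInv N) :=
  subalgebraPoisson (kwInv N) fun _ ha _ hb => kwInv_pb ha hb

/-- The functions of `kwInv N` that vanish on the level set. -/
def kwInvIdeal : Ideal (kwInv N) := (kwIdeal N).comap (kwInv N).val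

/-- The coordinate ring `ℂ[ℨ]` of the universal centraliser `ℨ` of `SL_N`, as the two-sided
Kostant–Whittaker reduction of `T^*SL_N`: the functions on the level set
`μ_L⁻¹(χ) ∩ μ_R⁻¹(χ)` that are invariant under `N_L × N_R`. -/
def UnivCent : Type := kwInv N ⧸ kwInvIdeal N

instance : CommRing (UnivCent N) := inferInstanceAs (CommRing (kwInv N ⧸ kwInvIdeal N))

instance : Algebra ℂ (UnivCent N) := inferInstanceAs (Algebra ℂ (kwInv N ⧸ kwInvIdeal N))

/-- The class in `ℂ[ℨ]` of a function on `T^*SL_N`. -/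
def toUnivCent : kwInv N →ₐ[ℂ] UnivCent N := Ideal.Quotient.mkₐ ℂ (kwInvIdeal N)

/-- The reduced Poisson structure: the bracket of two classes is the class of the bracket in
`ℂ[T^*SL_N]` of any representatives. -/
instance univCentPoisson : PoissonAlg (UnivCent N) :=
  quotientPoisson (kwInvIdeal N) fun a _ hb => kwInv_pb_ideal a.2 hb

theorem pb_toUnivCent (a b : kwInv N) :
    PoissonAlg.pb (toUnivCent N a) (toUnivCent N b) = toUnivCent N (PoissonAlg.pb a b) := rfl

/-! ### The generators -/

/-- `ℂ[𝔤^*]^G`, inside `ℂ[T^*SL_N]` via the moment map `x`. -/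
def coadjInv : Subalgebra ℂ (CotSL N) where
  carrier := {F | F ∈ Algebra.adjoin ℂ (Set.range fun p : Fin N × Fin N => matX N p.1 p.2) ∧
    ∀ h : SpecialLinearGroup (Fin N) ℂ, rightTr h F = F}
  mul_mem' := fun ha hb => ⟨mul_mem ha.1 hb.1, fun h => by rw [map_mul, ha.2, hb.2]⟩
  add_mem' := fun ha hb => ⟨add_mem ha.1 hb.1, fun h => by rw [map_add, ha.2, hb.2]⟩
  algebraMap_mem' := fun r => ⟨algebraMap_mem _ r, fun _ => AlgHom.commutes _ r⟩

theorem coadjInv_le : coadjInv N ≤ kwInv N := by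
  rintro F ⟨h1, h2⟩ h -
  have : leftTr h F = F := by
    have hle : Algebra.adjoin ℂ (Set.range fun p : Fin N × Fin N => matX N p.1 p.2) ≤
        AlgHom.equalizer (leftTr h) (AlgHom.id ℂ _) := by
      refine Algebra.adjoin_le ?_
      rintro _ ⟨p, rfl⟩
      exact congrFun (congrFun (map_leftTr_X h) p.1) p.2
    exact hle h1
  rw [h2, this, sub_self]
  exact ⟨Ideal.zero_mem _, Ideal.zero_mem _⟩

/-- The map `ℂ[𝔤^*]^G → ℂ[ℨ]`. -/
def invToUnivCent : coadjInv N →ₐ[ℂ] UnivCent N :=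
  (toUnivCent N).comp (Subalgebra.inclusion (coadjInv_le N))

/-- The lower left matrix entry `g_{N1}` is invariant. -/
theorem corner_mem [NeZero N] : matG N (Fin.rev 0) 0 ∈ kwInv N := by
  intro h hh
  have hlast : ∀ k : Fin N, k ≠ Fin.rev 0 → k < Fin.rev 0 := by
    intro k hk
    refine lt_of_le_of_ne ?_ hk
    rw [← Fin.rev_le_rev, Fin.rev_rev]
    exact Fin.zero_le _
  have e1 : rightTr h (matG N (Fin.rev 0) 0) = matG N (Fin.rev 0) 0 := by
    refine (congrFun (congrFun (map_rightTr_G h) _) _).trans ?_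
    rw [Matrix.mul_apply, Finset.sum_eq_single 0]
    · simp [cst, (hh 0).1]
    · intro k _ hk
      have : h.1 k 0 = 0 := (hh k).2 0 (lt_of_le_of_ne (Fin.zero_le _) (Ne.symm hk))
      simp [cst, this]
    · simp
  have e2 : leftTr h (matG N (Fin.rev 0) 0) = matG N (Fin.rev 0) 0 := by
    refine (congrFun (congrFun (map_leftTr_G h) _) _).trans ?_
    rw [Matrix.mul_apply, Finset.sum_eq_single (Fin.rev 0)]
    · simp [cst, (hh (Fin.rev 0)).1]
    · intro k _ hk
      have : h.1 (Fin.rev 0) k = 0 := (hh _).2 k (hlast k hk)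
      simp [cst, this]
    · simp
  rw [e1, e2, sub_self]
  exact ⟨Ideal.zero_mem _, Ideal.zero_mem _⟩

/-- The function `X = g_{N1}` on the universal centraliser. -/
def cornerX [NeZero N] : UnivCent N := toUnivCent N ⟨matG N (Fin.rev 0) 0, corner_mem N⟩

end Reduction

end UCent

end

/-! A point of the level set with values in an algebra $B$ is a pair $(g,x)$ such that $x$ and
$y=gxg^{-1}$ both lie in $f+\mathfrak b$. For such an $x$ the Krylov matrix
$u=(e_1,xe_1,\dots,x^{N-1}e_1)$ is unitriangular, and by Cayley–Hamilton $u^{-1}xu=K$ is the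
companion matrix of the characteristic polynomial of $x$. As $y$ has the same characteristic
polynomial, its Krylov matrix $v$ gives $v^{-1}yv=K$ as well. Acting by $u$ on the right and by
$v^{-1}$ on the left therefore moves $(g,x)$ to $(g',K)$, where $g'=v^{-1}gu$ commutes with $K$.

A matrix commuting with $K$ is recovered from its last row, with coefficients polynomial in the
entries of $K$ (`apply_mem_of_commute_companionMatrix`). Multiplication by $v$ does not change the
last row, so the last row of $g'$ is that of $gu$, whose entries are $(gx^k)_{N1}$ for $0\le k<N$.
Hence an invariant function takes at $(g,x)$ a value polynomial in these entries and in the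
coefficients of the characteristic polynomial of $x$ (`apply_mem_map_of_mem_kwInv`). Applied to the
tautological point with values in the coordinate ring of the level set, this gives algebra
generators of the reduction.

The matrices $u,v$ have entries in $B$, whereas invariance is assumed under complex unitriangular
matrices only. The gap is closed by density: a polynomial with coefficients in $B$ is determined by
its values at complex arguments (`mvPolynomial_ext_eval_algebraMap`).

The Poisson bracket enters only at the end. By `pb_trace_pow_matG`,
$\{\mathrm{tr}\,x^{k+1},g_{N1}\}$ is a nonzero multiple of
$(gx^k)_{N1}-\frac1N\mathrm{tr}(x^k)\,g_{N1}$. Traces of powers and coefficients of the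
characteristic polynomial are coadjoint invariants, hence polynomials in the $P_i$; so every algebra
generator above lies in the Poisson subalgebra generated by the $P_i$ and $X$. -/

noncomputable section

namespace UCent

open Matrix

/-! ### Companion matrices and the Krylov basis -/

section Krylov

variable {N : ℕ} {B : Type*} [CommRing B]

/-- The matrix lies in `f + 𝔟`. -/
def IsHess (x : Matrix (Fin N) (Fin N) B) : Prop :=
  ∀ i j : Fin N, j < i → x i j = if (i : ℕ) = j + 1 then 1 else 0

/-- Upper unitriangular matrices over any ring. -/
def IsUnitri (u : Matrix (Fin N) (Fin N) B) : Prop :=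
  ∀ i, u i i = 1 ∧ ∀ j < i, u i j = 0

theorem IsUnitri.det {u : Matrix (Fin N) (Fin N) B} (hu : IsUnitri u) : u.det = 1 := by
  rw [Matrix.det_of_isUpperTriangular fun i j h => (hu i).2 j h]
  exact Finset.prod_eq_one fun i _ => (hu i).1

/-- The matrix of the polynomial `z ^ N + ∑ c_k z ^ k` acting on `1, z, …, z ^ (N - 1)`. -/
def companionMatrix (c : ℕ → B) : Matrix (Fin N) (Fin N) B :=
  .of fun i j => if (j : ℕ) + 1 < N then (if (i : ℕ) = j + 1 then 1 else 0) else - c i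

theorem isHess_companionMatrix (c : ℕ → B) :
    IsHess (companionMatrix c : Matrix (Fin N) (Fin N) B) := by
  intro i j h
  have h' : (j : ℕ) < i := h
  rw [companionMatrix, of_apply, if_pos (by omega)]

/-- Cayley–Hamilton, solved for the top power; it supplies the last column of the companion matrix
in `mul_krylov_eq`. -/
theorem charpoly_pow_eq (x : Matrix (Fin N) (Fin N) B) :
    x ^ N = - ∑ k : Fin N, x.charpoly.coeff k • x ^ (k : ℕ) := by
  nontriviality B
  have h := x.aeval_self_charpoly
  rw [x.charpoly_monic.as_sum, x.charpoly_natDegree_eq_dim, Fintype.card_fin] at h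
  simp only [map_add, map_pow, Polynomial.aeval_X, map_sum, map_mul, Polynomial.aeval_C] at h
  rw [eq_neg_of_add_eq_zero_left h, Finset.sum_range]
  simp only [Algebra.smul_def]

variable [NeZero N]

/-- A matrix in $f+\mathfrak b$ sends $e_j$ to $e_{j+1}$ plus a combination of $e_1,\dots,e_j$, so
$x^ke_1$ is $e_{k+1}$ plus earlier basis vectors. Nothing is claimed about the entries above
position $k$. -/
theorem IsHess.pow_apply_zero {x : Matrix (Fin N) (Fin N) B} (hx : IsHess x) (k : ℕ) (i : Fin N)
    (h : k ≤ i) : (x ^ k) i 0 = if (i : ℕ) = k then 1 else 0 := by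
  induction k generalizing i with
  | zero => rw [pow_zero, Matrix.one_apply]; exact if_congr (by rw [Fin.ext_iff, Fin.val_zero]) rfl rfl
  | succ k ih =>
    have hk : k < N := by omega
    rw [pow_succ', Matrix.mul_apply, Finset.sum_eq_single ⟨k, hk⟩]
    · rw [ih _ le_rfl, if_pos rfl, mul_one, hx _ _ (Fin.lt_def.2 (by simp only; omega))]
    · intro j _ hj
      have hj' : (j : ℕ) ≠ k := fun e => hj (Fin.ext e)
      rcases lt_or_ge (j : ℕ) k with h1 | h1
      · rw [hx i j (Fin.lt_def.2 (by omega)), if_neg (by omega), zero_mul]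
      · rw [ih j h1, if_neg hj', mul_zero]
    · simp

/-- The matrix with columns `e₁, x e₁, …, x ^ (N - 1) e₁`. -/
def krylov (x : Matrix (Fin N) (Fin N) B) : Matrix (Fin N) (Fin N) B :=
  .of fun i j => (x ^ (j : ℕ)) i 0

theorem mul_krylov (g x : Matrix (Fin N) (Fin N) B) (i j : Fin N) :
    (g * krylov x) i j = (g * x ^ (j : ℕ)) i 0 := rfl

theorem isUnitri_krylov {x : Matrix (Fin N) (Fin N) B} (hx : IsHess x) :
    IsUnitri (krylov x) := by
  intro i
  refine ⟨(hx.pow_apply_zero _ _ le_rfl).trans (if_pos rfl), fun j hj => ?_⟩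
  have hj' : (j : ℕ) < i := hj
  exact (hx.pow_apply_zero _ _ hj'.le).trans (if_neg hj'.ne')

/-- Multiplication by $x$ shifts the Krylov columns $x^je_1$ by one, and Cayley–Hamilton rewrites
the column $x^Ne_1$ that falls off the end. This holds for every $x$; only the invertibility of the
Krylov matrix needs $x\in f+\mathfrak b$. -/
theorem mul_krylov_eq (x : Matrix (Fin N) (Fin N) B) :
    x * krylov x = krylov x * companionMatrix x.charpoly.coeff := by
  ext i j
  rw [mul_krylov, ← pow_succ', Matrix.mul_apply]
  simp only [krylov, companionMatrix, of_apply]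
  by_cases hj : (j : ℕ) + 1 < N
  · simp only [if_pos hj]
    rw [Finset.sum_eq_single ⟨j + 1, hj⟩]
    · simp
    · intro k _ hk
      rw [if_neg fun e => hk (Fin.ext e), mul_zero]
    · simp
  · simp only [if_neg hj]
    have : (j : ℕ) + 1 = N := by omega
    rw [this, charpoly_pow_eq, Matrix.neg_apply, Matrix.sum_apply, ← Finset.sum_neg_distrib]
    refine Finset.sum_congr rfl fun k _ => ?_
    rw [Matrix.smul_apply, smul_eq_mul]; ring

/-- A matrix commuting with a companion matrix is determined by its last row. -/
theorem apply_mem_of_commute_companionMatrix {R : Type*} [CommRing R] [Algebra R B]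
    (Q : Subalgebra R B) {c : ℕ → B} (hc : ∀ i : Fin N, c i ∈ Q) {g : Matrix (Fin N) (Fin N) B}
    (hg : g * companionMatrix c = companionMatrix c * g) (hlast : ∀ j, g (Fin.rev 0) j ∈ Q)
    (i j : Fin N) : g i j ∈ Q := by
  have hC : ∀ i j : Fin N, (companionMatrix c : Matrix (Fin N) (Fin N) B) i j ∈ Q := by
    intro i j
    rw [companionMatrix, of_apply]
    split_ifs
    · exact one_mem Q
    · exact zero_mem Q
    · exact neg_mem (hc i)
  -- Induction upwards from the last row, with $d$ the distance of row $i$ from it.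
  have key : ∀ (d : ℕ) (i : Fin N), (i : ℕ) + d + 1 = N → ∀ j, g i j ∈ Q := by
    intro d
    induction d with
    | zero =>
      intro i hi j
      have : i = Fin.rev 0 := by
        apply Fin.ext
        rw [Fin.val_rev, Fin.val_zero]
        omega
      rw [this]; exact hlast j
    | succ d ih =>
      intro i hi j
      have hi' : (i : ℕ) + 1 < N := by omega
      have h1 := congrFun (congrFun hg ⟨i + 1, hi'⟩) j
      -- Row $i+1$ of the companion matrix has only two possibly nonzero entries: $1$ in column $i$
      -- and $-c_{i+1}$ in the last column. Comparing row $i+1$ of both sides of the commutation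
      -- relation therefore expresses row $i$ of $g$ through row $i+1$ and the last row.
      have h2 : (companionMatrix c * g : Matrix (Fin N) (Fin N) B) ⟨i + 1, hi'⟩ j =
          g i j - c (i + 1) * g (Fin.rev 0) j := by
        have hne : i ≠ Fin.rev 0 := by
          rintro rfl
          rw [Fin.val_rev, Fin.val_zero] at hi'
          omega
        rw [Matrix.mul_apply, Finset.sum_eq_add i (Fin.rev 0) hne]
        · have hl : ¬ ((Fin.rev (0 : Fin N) : Fin N) : ℕ) + 1 < N := by
            rw [Fin.val_rev, Fin.val_zero]; omega
          simp only [companionMatrix, of_apply, if_pos hi', if_neg hl, if_true]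
          ring
        · rintro k - ⟨hk1, hk2⟩
          have hk : (k : ℕ) + 1 < N := by
            by_contra hk
            apply hk2
            apply Fin.ext
            rw [Fin.val_rev, Fin.val_zero]
            omega
          simp only [companionMatrix, of_apply, if_pos hk]
          rw [if_neg, zero_mul]
          intro e
          exact hk1 (Fin.ext (by omega))
        · simp
        · simp
      rw [h2] at h1
      rw [eq_comm, sub_eq_iff_eq_add] at h1
      rw [h1]
      refine add_mem ?_ (mul_mem (hc ⟨i + 1, hi'⟩) (hlast j))
      rw [Matrix.mul_apply]
      exact sum_mem fun k _ => mul_mem (ih _ (by simp only; omega) k) (hC k j)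
  exact key (N - 1 - i) i (by omega) j

end Krylov

/-! ### Invariance under unitriangular matrices over an algebra -/

/-- Zariski density of the complex points, with coefficients in an arbitrary `ℂ`-algebra. A linear
functional on $B$ applied to the coefficients reduces it to complex polynomials, where it holds
because `ℂ` is infinite; no finiteness or reducedness of $B$ is needed. -/
theorem mvPolynomial_ext_eval_algebraMap {τ B : Type*} [CommRing B] [Algebra ℂ B]
    {p q : MvPolynomial τ B}
    (h : ∀ s : τ → ℂ, MvPolynomial.eval (fun a => algebraMap ℂ B (s a)) p =
      MvPolynomial.eval (fun a => algebraMap ℂ B (s a)) q) : p = q := by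
  classical
  rw [← sub_eq_zero]
  ext m
  rw [MvPolynomial.coeff_zero]
  by_contra hm
  -- A linear functional on $B$ that does not vanish on the chosen nonzero coefficient.
  obtain ⟨φ, h1, -⟩ := Submodule.exists_le_ker_of_notMem
    (p := (⊥ : Submodule ℂ B)) (v := (p - q).coeff m) (by simpa using hm)
  let r : MvPolynomial τ ℂ :=
    ∑ k ∈ (p - q).support, MvPolynomial.monomial k (φ ((p - q).coeff k))
  have hr : r = 0 := MvPolynomial.funext fun s => by
    have : φ (MvPolynomial.eval (fun a => algebraMap ℂ B (s a)) (p - q)) = 0 := by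
      rw [map_sub, h, sub_self, map_zero]
    rw [map_zero, ← this, MvPolynomial.eval_eq _ (p - q), map_sum, map_sum]
    refine Finset.sum_congr rfl fun k _ => ?_
    simp only [← map_pow, ← map_prod]
    rw [mul_comm ((p - q).coeff k), ← Algebra.smul_def, map_smul, MvPolynomial.eval_monomial,
      smul_eq_mul, mul_comm, Finsupp.prod]
  have hc : r.coeff m = φ ((p - q).coeff m) := by
    simp only [r, MvPolynomial.coeff_sum, MvPolynomial.coeff_monomial]
    rw [Finset.sum_ite_eq', if_pos (MvPolynomial.mem_support_iff.2 hm)]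
  rw [hr, MvPolynomial.coeff_zero] at hc
  exact h1 hc.symm

section Generic

variable {N : ℕ} {B : Type*} [CommRing B]

/-- The generic upper unitriangular matrix. -/
def genericUnitri (N : ℕ) (B : Type*) [CommRing B] :
    Matrix (Fin N) (Fin N) (MvPolynomial (Fin N × Fin N) B) :=
  .of fun i j => if i = j then 1 else if i < j then MvPolynomial.X (i, j) else 0

theorem isUnitri_genericUnitri : IsUnitri (genericUnitri N B) := by
  intro i
  refine ⟨by simp [genericUnitri], fun j hj => ?_⟩
  simp [genericUnitri, hj.ne', hj.not_gt]

theorem eval_genericUnitri {u : Matrix (Fin N) (Fin N) B} (hu : IsUnitri u) :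
    (genericUnitri N B).map (MvPolynomial.eval fun p => u p.1 p.2) = u := by
  ext i j
  simp only [genericUnitri, map_apply, of_apply]
  split_ifs with h h'
  · rw [map_one, h, (hu j).1]
  · rw [MvPolynomial.eval_X]
  · rw [map_zero, (hu i).2 j (lt_of_le_of_ne (not_lt.1 h') (Ne.symm h))]

end Generic

/-! ### Points of $T^*\mathrm{SL}_N$ with values in an algebra, and their normal form on the level
set -/

section Points

variable {N : ℕ} {B : Type*} [CommRing B] [Algebra ℂ B]

theorem cot_algHom_ext {φ ψ : CotSL N →ₐ[ℂ] B} (hX : (matX N).map φ = (matX N).map ψ)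
    (hG : (matG N).map φ = (matG N).map ψ) : φ = ψ := by
  ext F
  induction F using cot_induction with
  | hC r => rw [AlgHom.commutes, AlgHom.commutes]
  | hX i j => exact congrFun (congrFun hX i) j
  | hG i j => exact congrFun (congrFun hG i) j
  | hadd a b ha hb => rw [map_add, map_add, ha, hb]
  | hmul a b ha hb => rw [map_mul, map_mul, ha, hb]

theorem map_cotLift_X (x g : Matrix (Fin N) (Fin N) B) (hx : x.trace = 0) (hg : g.det = 1) :
    (matX N).map (cotLift x g hx hg) = x := by
  ext i j; exact cotLift_X x g hx hg i j

theorem map_cotLift_G (x g : Matrix (Fin N) (Fin N) B) (hx : x.trace = 0) (hg : g.det = 1) :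
    (matG N).map (cotLift x g hx hg) = g := by
  ext i j; exact cotLift_G x g hx hg i j

/-- The complex unitriangular matrix with the given entries above the diagonal. -/
def unitriOf (s : Fin N × Fin N → ℂ) : SpecialLinearGroup (Fin N) ℂ :=
  ⟨(genericUnitri N ℂ).map (MvPolynomial.eval s), by
    rw [← RingHom.mapMatrix_apply, ← RingHom.map_det, isUnitri_genericUnitri.det, map_one]⟩

theorem isUpperUnipotent_unitriOf (s : Fin N × Fin N → ℂ) : IsUpperUnipotent (unitriOf s) := by
  intro i
  change MvPolynomial.eval s _ = 1 ∧ ∀ j < i, MvPolynomial.eval s _ = 0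
  refine ⟨by rw [(isUnitri_genericUnitri i).1, map_one], fun j hj => ?_⟩
  rw [(isUnitri_genericUnitri i).2 j hj, map_zero]

theorem eval_genericUnitri_algebraMap (s : Fin N × Fin N → ℂ) :
    (genericUnitri N B).map (MvPolynomial.eval fun p => algebraMap ℂ B (s p)) =
      (unitriOf s).1.map (algebraMap ℂ B) := by
  ext i j
  simp only [genericUnitri, unitriOf, map_apply, of_apply]
  split_ifs <;> simp

/-- Evaluation as an algebra homomorphism over `ℂ`. -/
def evalHom (s : Fin N × Fin N → B) : MvPolynomial (Fin N × Fin N) B →ₐ[ℂ] B :=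
  (MvPolynomial.aeval s : MvPolynomial (Fin N × Fin N) B →ₐ[B] B).restrictScalars ℂ

theorem evalHom_apply (s : Fin N × Fin N → B) (p : MvPolynomial (Fin N × Fin N) B) :
    evalHom s p = MvPolynomial.eval s p := by
  change MvPolynomial.aeval s p = _
  rw [MvPolynomial.aeval_eq_eval]

theorem map_adjugate' {A A' : Type*} [CommRing A] [CommRing A'] [Algebra ℂ A] [Algebra ℂ A']
    (φ : A →ₐ[ℂ] A') (M : Matrix (Fin N) (Fin N) A) :
    M.adjugate.map φ = (M.map φ).adjugate :=
  AlgHom.map_adjugate φ M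

theorem map_trace' {A A' : Type*} [CommRing A] [CommRing A'] [Algebra ℂ A] [Algebra ℂ A']
    (φ : A →ₐ[ℂ] A') (M : Matrix (Fin N) (Fin N) A) : (M.map φ).trace = φ M.trace := by
  simp [Matrix.trace]

theorem map_det' {A A' : Type*} [CommRing A] [CommRing A'] [Algebra ℂ A] [Algebra ℂ A']
    (φ : A →ₐ[ℂ] A') (M : Matrix (Fin N) (Fin N) A) : (M.map φ).det = φ M.det :=
  (AlgHom.map_det φ M).symm

theorem trace_adjugate_mul_mul {A : Type*} [CommRing A] {u : Matrix (Fin N) (Fin N) A}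
    (hu : u.det = 1) (x : Matrix (Fin N) (Fin N) A) : (u.adjugate * x * u).trace = x.trace := by
  rw [Matrix.trace_mul_comm, ← mul_assoc, Matrix.mul_adjugate, hu, one_smul, one_mul]

theorem map_evalHom_genericUnitri {u : Matrix (Fin N) (Fin N) B} (hu : IsUnitri u) :
    (genericUnitri N B).map (evalHom fun p => u p.1 p.2) = u := by
  refine Eq.trans ?_ (eval_genericUnitri hu)
  ext i j
  simp only [map_apply, evalHom_apply]

theorem map_evalHom_genericUnitri_algebraMap (s : Fin N × Fin N → ℂ) :
    (genericUnitri N B).map (evalHom fun p => algebraMap ℂ B (s p)) =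
      (unitriOf s).1.map (algebraMap ℂ B) := by
  rw [← eval_genericUnitri_algebraMap]
  ext i j
  simp only [map_apply, evalHom_apply]

/-- The inclusion of the constants. -/
def constHom (N : ℕ) (B : Type*) [CommRing B] [Algebra ℂ B] :
    B →ₐ[ℂ] MvPolynomial (Fin N × Fin N) B :=
  IsScalarTower.toAlgHom ℂ B _

theorem map_evalHom_constHom (s : Fin N × Fin N → B) (M : Matrix (Fin N) (Fin N) B) :
    (M.map (constHom N B)).map (evalHom s) = M := by
  ext i j
  rw [map_apply, map_apply, evalHom_apply]
  exact MvPolynomial.eval_C _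

theorem map_comp (Φ : CotSL N →ₐ[ℂ] B) {A : Type*} [CommRing A] [Algebra ℂ A] (e : B →ₐ[ℂ] A)
    (M : Matrix (Fin N) (Fin N) (CotSL N)) : M.map (e.comp Φ) = (M.map Φ).map e := by
  ext i j; rfl

/-- A polynomial family of points is constant on `F` if it is so at complex parameters. -/
theorem evalHom_apply_eq_of_algebraMap (Φ : CotSL N →ₐ[ℂ] MvPolynomial (Fin N × Fin N) B)
    (F : CotSL N) (b : B)
    (h : ∀ s : Fin N × Fin N → ℂ, evalHom (fun p => algebraMap ℂ B (s p)) (Φ F) = b)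
    (u : Fin N × Fin N → B) : evalHom u (Φ F) = b := by
  have : Φ F = MvPolynomial.C b := mvPolynomial_ext_eval_algebraMap fun s => by
    rw [← evalHom_apply, h, MvPolynomial.eval_C]
  rw [this, evalHom_apply, MvPolynomial.eval_C]

/-- Left translation by a unitriangular matrix over $B$ does not change the value of an invariant
function at a point of the level set. The translates by the generic unitriangular matrix form a
polynomial family on which $F$ is constant at complex parameters by invariance; by density it is
constant, in particular at the parameters of $u$. -/
theorem apply_eq_of_left_unitri {F : CotSL N} (hF : F ∈ kwInv N) {φ φ' : CotSL N →ₐ[ℂ] B}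
    (hφ : ∀ a ∈ kwIdeal N, φ a = 0) {u : Matrix (Fin N) (Fin N) B} (hu : IsUnitri u)
    (hX : (matX N).map φ' = (matX N).map φ) (hG : (matG N).map φ' = u * (matG N).map φ) :
    φ' F = φ F := by
  -- The translate of the point $\varphi$ by the generic unitriangular matrix.
  let Φ : CotSL N →ₐ[ℂ] MvPolynomial (Fin N × Fin N) B :=
    cotLift (((matX N).map φ).map (constHom N B))
      (genericUnitri N B * ((matG N).map φ).map (constHom N B))
      (by rw [map_trace', map_trace', trace_matX, map_zero, map_zero])
      (by rw [det_mul, map_det', map_det', det_matG, map_one, map_one, mul_one]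
          exact isUnitri_genericUnitri.det)
  have h1 : φ' = (evalHom fun p => u p.1 p.2).comp Φ := by
    refine cot_algHom_ext ?_ ?_
    · rw [hX, map_comp, map_cotLift_X, map_evalHom_constHom]
    · rw [hG, map_comp, map_cotLift_G, Matrix.map_mul, map_evalHom_constHom,
        map_evalHom_genericUnitri hu]
  rw [h1]
  refine evalHom_apply_eq_of_algebraMap Φ F _ (fun s => ?_) _
  -- At complex parameters the family is $\varphi$ composed with an honest translation, so the
  -- invariance hypothesis applies.
  have h2 : (evalHom fun p => algebraMap ℂ B (s p)).comp Φ = φ.comp (leftTr (unitriOf s)) := by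
    refine cot_algHom_ext ?_ ?_
    · rw [map_comp, map_comp, map_cotLift_X, map_evalHom_constHom, map_leftTr_X]
    · rw [map_comp, map_comp, map_cotLift_G, Matrix.map_mul, map_evalHom_constHom, map_leftTr_G,
        Matrix.map_mul, map_cst, map_evalHom_genericUnitri_algebraMap]
  refine (DFunLike.congr_fun h2 F).trans ?_
  rw [← sub_eq_zero, AlgHom.comp_apply, ← map_sub]
  exact hφ _ (hF _ (isUpperUnipotent_unitriOf s)).2

/-- The counterpart for right translations $(g,x)\mapsto(gu,u^{-1}xu)$, by the same density
argument; as $\det u=1$, the adjugate stands for the inverse. -/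
theorem apply_eq_of_right_unitri {F : CotSL N} (hF : F ∈ kwInv N) {φ φ' : CotSL N →ₐ[ℂ] B}
    (hφ : ∀ a ∈ kwIdeal N, φ a = 0) {u : Matrix (Fin N) (Fin N) B} (hu : IsUnitri u)
    (hX : (matX N).map φ' = u.adjugate * (matX N).map φ * u)
    (hG : (matG N).map φ' = (matG N).map φ * u) :
    φ' F = φ F := by
  let Φ : CotSL N →ₐ[ℂ] MvPolynomial (Fin N × Fin N) B :=
    cotLift ((genericUnitri N B).adjugate * ((matX N).map φ).map (constHom N B) *
        genericUnitri N B)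
      (((matG N).map φ).map (constHom N B) * genericUnitri N B)
      (by rw [trace_adjugate_mul_mul isUnitri_genericUnitri.det, map_trace', map_trace',
            trace_matX, map_zero, map_zero])
      (by rw [det_mul, map_det', map_det', det_matG, map_one, map_one, one_mul]
          exact isUnitri_genericUnitri.det)
  have h1 : φ' = (evalHom fun p => u p.1 p.2).comp Φ := by
    refine cot_algHom_ext ?_ ?_
    · rw [hX, map_comp, map_cotLift_X, Matrix.map_mul, Matrix.map_mul, map_evalHom_constHom,
        map_adjugate', map_evalHom_genericUnitri hu]
    · rw [hG, map_comp, map_cotLift_G, Matrix.map_mul, map_evalHom_constHom,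
        map_evalHom_genericUnitri hu]
  rw [h1]
  refine evalHom_apply_eq_of_algebraMap Φ F _ (fun s => ?_) _
  have h2 : (evalHom fun p => algebraMap ℂ B (s p)).comp Φ = φ.comp (rightTr (unitriOf s)) := by
    refine cot_algHom_ext ?_ ?_
    · rw [map_comp, map_comp, map_cotLift_X, Matrix.map_mul, Matrix.map_mul,
        map_evalHom_constHom, map_rightTr_X, Matrix.map_mul, Matrix.map_mul, map_cst, map_cst,
        map_adjugate', map_evalHom_genericUnitri_algebraMap]
      -- The inverse in $\mathrm{SL}_N$ is the adjugate, which commutes with extension of scalars.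
      congr 2
      exact ((algebraMap ℂ B).map_adjugate _).symm
    · rw [map_comp, map_comp, map_cotLift_G, Matrix.map_mul, map_evalHom_constHom, map_rightTr_G,
        Matrix.map_mul, map_cst, map_evalHom_genericUnitri_algebraMap]
  refine (DFunLike.congr_fun h2 F).trans ?_
  rw [← sub_eq_zero, AlgHom.comp_apply, ← map_sub]
  exact hφ _ (hF _ (isUpperUnipotent_unitriOf s)).1

theorem map_momY (φ : CotSL N →ₐ[ℂ] B) : (momY N).map φ =
    (matG N).map φ * (matX N).map φ * ((matG N).map φ).adjugate := by
  rw [momY, Matrix.map_mul, Matrix.map_mul, map_adjugate']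

/-- The defining equations of the level set, read on $B$-valued points: the point lies on it exactly
when both moment maps take values in $f+\mathfrak b$. -/
theorem vanishes_iff_isHess (φ : CotSL N →ₐ[ℂ] B) : (∀ a ∈ kwIdeal N, φ a = 0) ↔
    IsHess ((matX N).map φ) ∧ IsHess ((momY N).map φ) := by
  have e : ∀ i j, φ (algebraMap ℂ _ (lowF N i j)) = if (i : ℕ) = j + 1 then 1 else 0 := by
    intro i j
    rw [AlgHom.commutes, lowF, of_apply]
    split_ifs <;> simp
  constructor
  · intro h
    refine ⟨fun i j hij => ?_, fun i j hij => ?_⟩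
    · have := h _ (momX_rel_mem hij)
      rwa [map_sub, e, sub_eq_zero] at this
    · have := h _ (momY_rel_mem hij)
      rwa [map_sub, e, sub_eq_zero] at this
  · rintro ⟨h1, h2⟩ a ha
    have hle : kwIdeal N ≤ RingHom.ker φ := by
      refine Ideal.span_le.2 ?_
      rintro _ ⟨i, j, hij, rfl | rfl⟩
      · rw [SetLike.mem_coe, RingHom.mem_ker, map_sub, e, sub_eq_zero]
        exact h1 i j hij
      · rw [SetLike.mem_coe, RingHom.mem_ker, map_sub, e, sub_eq_zero]
        exact h2 i j hij
    exact hle ha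

/-- On the level set an invariant function is a polynomial in the coefficients of the
characteristic polynomial of `x` and the entries `(g x^k)_{N1}`. -/
theorem apply_mem_map_of_mem_kwInv [NeZero N] {F : CotSL N} (hF : F ∈ kwInv N)
    {φ : CotSL N →ₐ[ℂ] B} (hφ : ∀ a ∈ kwIdeal N, φ a = 0) (Q : Subalgebra ℂ (CotSL N))
    (hc : ∀ k, (matX N).charpoly.coeff k ∈ Q)
    (hr : ∀ k : Fin N, (matG N * matX N ^ (k : ℕ)) (Fin.rev 0) 0 ∈ Q) : φ F ∈ Q.map φ := by
  obtain ⟨hx, hy⟩ := (vanishes_iff_isHess φ).1 hφ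
  rw [map_momY] at hy
  have hdet : ((matG N).map φ).det = 1 := by rw [map_det', det_matG, map_one]
  have htr : ((matX N).map φ).trace = 0 := by rw [map_trace', trace_matX, map_zero]
  have hchar : ((matX N).map φ).charpoly.coeff = fun k => φ ((matX N).charpoly.coeff k) := by
    funext k
    have : (matX N).map φ = (matX N).map (φ : CotSL N →+* B) := rfl
    rw [this, Matrix.charpoly_map, Polynomial.coeff_map]; rfl
  have hlast : ∀ k : Fin N,
      ((matG N).map φ * (matX N).map φ ^ (k : ℕ)) (Fin.rev 0) 0 ∈ Q.map φ := by
    intro k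
    refine ⟨_, hr k, ?_⟩
    have : (matG N).map φ * (matX N).map φ ^ (k : ℕ) = (matG N * matX N ^ (k : ℕ)).map φ := by
      rw [Matrix.map_mul]
      congr 1
      exact (map_pow φ.mapMatrix (matX N) k).symm
    rw [this]; rfl
  have hcQ : ∀ k, ((matX N).map φ).charpoly.coeff k ∈ Q.map φ := by
    intro k
    rw [hchar]
    exact ⟨_, hc k, rfl⟩
  generalize hgdef : (matG N).map φ = g at *
  generalize hxdef : (matX N).map φ = x at *
  have hg2 : g.adjugate * g = 1 := by rw [Matrix.adjugate_mul, hdet, one_smul]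
  set y := g * x * g.adjugate with hydef
  -- Conjugate matrices share a characteristic polynomial, so $x$ and $y$ are brought to the same
  -- companion matrix $K$.
  have hyx : y.charpoly = x.charpoly := by
    rw [hydef, Matrix.charpoly_mul_comm, ← mul_assoc, hg2, one_mul]
  have hux := isUnitri_krylov hx
  have huy := isUnitri_krylov hy
  have hxu := mul_krylov_eq x
  have hyu := mul_krylov_eq y
  rw [hyx] at hyu
  have hgu : ∀ k : Fin N, (g * krylov x) (Fin.rev 0) k ∈ Q.map φ := hlast
  set c := x.charpoly.coeff
  set u := krylov x
  set v := krylov y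
  set K : Matrix (Fin N) (Fin N) B := companionMatrix c with hK
  have hu2 : u.adjugate * u = 1 := by rw [Matrix.adjugate_mul, hux.det, one_smul]
  have hv1 : v * v.adjugate = 1 := by rw [Matrix.mul_adjugate, huy.det, one_smul]
  have hv2 : v.adjugate * v = 1 := by rw [Matrix.adjugate_mul, huy.det, one_smul]
  have hKx : u.adjugate * x * u = K := by rw [mul_assoc, hxu, ← mul_assoc, hu2, one_mul]
  -- Both Krylov matrices have determinant $1$, so this is $v^{-1}gu$, the group component of the
  -- normal form.
  set g' := v.adjugate * (g * u) with hg'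
  have hvg' : v * g' = g * u := by rw [hg', ← mul_assoc, hv1, one_mul]
  have hyg : y * g = g * x := by rw [hydef, mul_assoc, hg2, mul_one]
  -- $v^{-1}guK=v^{-1}gxu=v^{-1}ygu=v^{-1}yvg'=Kg'$.
  have hcomm : g' * K = K * g' := by
    calc g' * K = v.adjugate * (g * (u * K)) := by rw [hg']; simp only [mul_assoc]
      _ = v.adjugate * (y * (v * g')) := by
        rw [← hxu, hvg', ← mul_assoc g x, ← hyg, mul_assoc]
      _ = K * g' := by
        rw [← mul_assoc y, hyu, mul_assoc v, ← mul_assoc, hv2, one_mul]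
  have hdet' : g'.det = 1 := by
    have := congrArg Matrix.det hvg'
    rwa [det_mul v, det_mul g, huy.det, hux.det, hdet, one_mul, one_mul] at this
  have hKtr : K.trace = 0 := by rw [← hKx, trace_adjugate_mul_mul hux.det, htr]
  -- The last row of the unitriangular $v$ is $(0,\dots,0,1)$, so $g'$ and $vg'=gu$ have the same
  -- last row.
  have hg'last : ∀ j, g' (Fin.rev 0) j ∈ Q.map φ := by
    intro j
    have h1 := hgu j
    rw [← hvg', Matrix.mul_apply, Finset.sum_eq_single (Fin.rev 0), (huy _).1, one_mul] at h1
    · exact h1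
    · intro k _ hk
      rw [(huy _).2 k, zero_mul]
      refine lt_of_le_of_ne ?_ hk
      rw [← Fin.rev_le_rev, Fin.rev_rev]
      exact Fin.zero_le _
    · simp
  have hg'mem := apply_mem_of_commute_companionMatrix (Q.map φ) (fun i : Fin N => hcQ i) hcomm
    hg'last
  -- The normal form $(g',K)$; next to it the intermediate point $(gu,K)$, which is a right
  -- translate of $(g,x)$ and a left translate of $(g',K)$.
  let φ₂ : CotSL N →ₐ[ℂ] B := cotLift K g' hKtr hdet'
  let φ₁ : CotSL N →ₐ[ℂ] B := cotLift K (g * u) hKtr (by rw [det_mul, hux.det, hdet, one_mul])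
  -- As $g'$ commutes with $K$, both moment maps take the value $K$ at the normal form, so it lies
  -- on the level set.
  have hφ₂ : ∀ a ∈ kwIdeal N, φ₂ a = 0 := by
    rw [vanishes_iff_isHess, map_momY, map_cotLift_X, map_cotLift_G, hcomm, mul_assoc,
      Matrix.mul_adjugate, hdet', one_smul, mul_one]
    exact ⟨isHess_companionMatrix _, isHess_companionMatrix _⟩
  have e1 : φ₁ F = φ F := by
    refine apply_eq_of_right_unitri hF hφ hux ?_ ?_
    · rw [map_cotLift_X, hxdef, hKx]
    · rw [map_cotLift_G, hgdef]
  have e2 : φ₁ F = φ₂ F := by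
    refine apply_eq_of_left_unitri hF hφ₂ huy ?_ ?_
    · rw [map_cotLift_X, map_cotLift_X]
    · rw [map_cotLift_G, map_cotLift_G, hvg']
  rw [← e1, e2]
  -- From here on invariance plays no role: every function on $T^*\mathrm{SL}_N$, evaluated at
  -- $(g',K)$, is a polynomial in the entries of $g'$ and $K$.
  clear e1 e2 hF
  induction F using cot_induction with
  | hC r => rw [AlgHom.commutes]; exact algebraMap_mem _ r
  | hX i j =>
    rw [cotLift_X, hK, companionMatrix, of_apply]
    split_ifs
    · exact one_mem _
    · exact zero_mem _
    · exact neg_mem (hcQ i)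
  | hG i j => rw [cotLift_G]; exact hg'mem i j
  | hadd a b ha hb => rw [map_add]; exact add_mem ha hb
  | hmul a b ha hb => rw [map_mul]; exact mul_mem ha hb

end Points

/-! ### Invariants and their brackets -/

section Invariants

variable {N : ℕ}

/-- The coefficients are polynomials in the $x_{ij}$, seen by computing over the subalgebra these
generate, and are unchanged by conjugation. -/
theorem charpoly_coeff_mem_coadjInv (k : ℕ) : (matX N).charpoly.coeff k ∈ coadjInv N := by
  constructor
  · let S := Algebra.adjoin ℂ (Set.range fun p : Fin N × Fin N => matX N p.1 p.2)
    let M : Matrix (Fin N) (Fin N) S := .of fun i j => ⟨matX N i j, Algebra.subset_adjoin ⟨(i, j), rfl⟩⟩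
    have hM : matX N = M.map (S.val : S →+* CotSL N) := rfl
    rw [hM, Matrix.charpoly_map, Polynomial.coeff_map]
    exact (M.charpoly.coeff k).2
  · intro h
    have e : rightTr h ((matX N).charpoly.coeff k) =
        ((matX N).map (rightTr h : CotSL N →+* CotSL N)).charpoly.coeff k := by
      rw [Matrix.charpoly_map, Polynomial.coeff_map]; rfl
    have e' : (matX N).map (rightTr h : CotSL N →+* CotSL N) = _ := map_rightTr_X h
    rw [e, e', Matrix.charpoly_mul_comm, ← mul_assoc, cst_mul_inv, one_mul]

theorem map_rightTr_X_pow (h : SpecialLinearGroup (Fin N) ℂ) (k : ℕ) :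
    (matX N ^ k).map (rightTr h) = cst h⁻¹.1 * matX N ^ k * cst h.1 := by
  have e : (matX N ^ k).map (rightTr h) = ((matX N).map (rightTr h)) ^ k :=
    map_pow (rightTr h).mapMatrix (matX N) k
  rw [e, map_rightTr_X]
  induction k with
  | zero => rw [pow_zero, pow_zero, mul_one, cst_inv_mul]
  | succ k ih =>
    rw [pow_succ, ih (map_pow (rightTr h).mapMatrix (matX N) k), pow_succ]
    simp only [mul_assoc]
    rw [← mul_assoc (cst h.1), cst_mul_inv, one_mul]

theorem trace_pow_mem_coadjInv (k : ℕ) : (matX N ^ k).trace ∈ coadjInv N := by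
  constructor
  · let S := Algebra.adjoin ℂ (Set.range fun p : Fin N × Fin N => matX N p.1 p.2)
    let M : Matrix (Fin N) (Fin N) S := .of fun i j => ⟨matX N i j, Algebra.subset_adjoin ⟨(i, j), rfl⟩⟩
    have hM : matX N ^ k = (M ^ k).map S.val := (map_pow S.val.mapMatrix M k).symm
    rw [hM, map_trace']
    exact (M ^ k).trace.2
  · intro h
    rw [← map_trace', map_rightTr_X_pow, Matrix.trace_mul_comm, ← mul_assoc, cst_mul_inv, one_mul]

/-- The Leibniz rule, whose $k+1$ terms agree by cyclicity of the trace. -/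
theorem derivation_trace_pow (D : Derivation ℂ (CotSL N) (CotSL N))
    (M : Matrix (Fin N) (Fin N) (CotSL N)) (k : ℕ) :
    D (M ^ (k + 1)).trace = (k + 1 : ℂ) • (M ^ k * M.map D).trace := by
  have e : ∀ M : Matrix (Fin N) (Fin N) (CotSL N), D M.trace = (M.map D).trace := fun M => by
    simp [Matrix.trace]
  -- The extra power $M^m$ makes the induction close: cyclicity moves one factor of $M$ from the
  -- right into it. For $l=m=0$ the truncated exponent is harmless, the coefficient being $0$.
  have key : ∀ (l m : ℕ), (M ^ m * (M ^ l).map D).trace =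
      (l : ℂ) • (M ^ (m + l - 1) * M.map D).trace := by
    intro l
    induction l with
    | zero =>
      intro m
      have : (1 : Matrix (Fin N) (Fin N) (CotSL N)).map D = 0 := by
        rw [← cst_one, map_derivation_cst]
      simp [this]
    | succ l ih =>
      intro m
      have := ih (m + 1)
      rw [pow_succ, map_derivation_mul, mul_add, Matrix.trace_add, ← mul_assoc,
        Matrix.trace_mul_comm _ M, ← mul_assoc, ← pow_succ', this, ← mul_assoc, ← pow_add,
        Nat.cast_succ, add_smul, one_smul]
      congr 5
      omega
  have := key (k + 1) 0
  rw [pow_zero, one_mul] at this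
  rw [e, this]
  simp

/-- `{tr x^(k+1), g} = (k+1)/2N · (g x^k - (tr x^k / N) g)`. -/
theorem pb_trace_pow_matG (k : ℕ) (a b : Fin N) :
    PoissonAlg.pb (matX N ^ (k + 1)).trace (matG N a b) = ((k + 1) / (2 * N) : ℂ) •
      ((matG N * matX N ^ k) a b - (1 / N : ℂ) • ((matX N ^ k).trace * matG N a b)) := by
  have h : (matX N).map (ham (matG N a b)) = - ((1 / (2 * N) : ℂ) •
      (Matrix.vecMulVec (fun i => algebraMap ℂ _ (kd N i b)) (fun j => matG N a j) -
        (algebraMap ℂ _ (1 / N : ℂ) * matG N a b) • (1 : Matrix (Fin N) (Fin N) (CotSL N)))) := by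
    ext i j
    rw [map_apply, ham_apply, PoissonAlg.pb_skew, pb_matX_matG, Matrix.neg_apply,
      Matrix.smul_apply, Matrix.sub_apply, Matrix.smul_apply, Matrix.vecMulVec_apply,
      Algebra.smul_def]
    congr 3
    simp only [kd, Matrix.one_apply, smul_eq_mul]
    split_ifs <;> simp
  -- The first term of the bracket is of rank one, the product of the basis vector $e_b$ with row
  -- $a$ of $g$, so its trace against $x^k$ is a single entry of $gx^k$.
  have h' : (matX N ^ k * Matrix.vecMulVec (fun i => algebraMap ℂ (CotSL N) (kd N i b))
      (fun j => matG N a j)).trace = (matG N * matX N ^ k) a b := by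
    have : (matX N ^ k) *ᵥ (fun i => algebraMap ℂ (CotSL N) (kd N i b)) =
        fun i => (matX N ^ k) i b := by
      ext i
      simp [Matrix.mulVec, dotProduct, kd, Matrix.one_apply, apply_ite (algebraMap ℂ (CotSL N))]
    rw [Matrix.mul_vecMulVec, this, Matrix.trace_vecMulVec, dotProduct_comm, Matrix.mul_apply]
    rfl
  rw [PoissonAlg.pb_skew, ← ham_apply, derivation_trace_pow, h, mul_neg, Matrix.mul_smul, mul_sub,
    Matrix.mul_smul, mul_one, Matrix.trace_neg, Matrix.trace_smul, Matrix.trace_sub, h',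
    Matrix.trace_smul, smul_neg, neg_neg, smul_smul]
  congr 2
  · ring
  · rw [smul_eq_mul, Algebra.smul_def]; ring

end Invariants

/-! ### Closure properties of the generated Poisson subalgebra -/

section Adjoin

variable {A : Type*} [CommRing A] [Algebra ℂ A] [PoissonAlg A]

theorem subset_poissonAdjoin (s : Set A) : s ⊆ poissonAdjoin A s := fun a ha => by
  rw [SetLike.mem_coe, poissonAdjoin, Algebra.mem_sInf]
  exact fun S hS => hS.1 ha

theorem pb_mem_poissonAdjoin {s : Set A} {a b : A} (ha : a ∈ poissonAdjoin A s)
    (hb : b ∈ poissonAdjoin A s) : PoissonAlg.pb a b ∈ poissonAdjoin A s := by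
  rw [poissonAdjoin, Algebra.mem_sInf] at *
  exact fun S hS => hS.2 a (ha S hS) b (hb S hS)

end Adjoin

end UCent

end

/-! ### Generation of the reduction by the $P_i$ and $X$ -/

theorem mainTheorem2 (N : ℕ) [NeZero N] {ι : Type*} (P : ι → UCent.coadjInv N)
    (hP : Algebra.adjoin ℂ (Set.range P) = ⊤) :
    UCent.poissonAdjoin (UCent.UnivCent N)
      (insert (UCent.cornerX N) (Set.range fun i => UCent.invToUnivCent N (P i))) = ⊤ := by
  set T := UCent.poissonAdjoin (UCent.UnivCent N)
    (insert (UCent.cornerX N) (Set.range fun i => UCent.invToUnivCent N (P i))) with hT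
  have hX : UCent.cornerX N ∈ T := UCent.subset_poissonAdjoin _ (Set.mem_insert _ _)
  have hinv : ∀ p, UCent.invToUnivCent N p ∈ T := by
    have : Algebra.adjoin ℂ (Set.range P) ≤ T.comap (UCent.invToUnivCent N) := by
      refine Algebra.adjoin_le ?_
      rintro _ ⟨i, rfl⟩
      exact UCent.subset_poissonAdjoin _ (Set.mem_insert_of_mem _ ⟨i, rfl⟩)
    rw [hP] at this
    exact fun p => this Algebra.mem_top
  -- The functions on $T^*\mathrm{SL}_N$ that are invariant on the level set and whose class lies in
  -- the generated Poisson subalgebra. Brackets can then be computed upstairs, and closure of $Q$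
  -- under them also yields the invariance of $(gx^k)_{N1}$.
  let Q : Subalgebra ℂ (UCent.CotSL N) := (T.comap (UCent.toUnivCent N)).map (UCent.kwInv N).val
  have hcQ : ∀ p ∈ UCent.coadjInv N, p ∈ Q := fun p hp =>
    ⟨⟨p, UCent.coadjInv_le N hp⟩, hinv ⟨p, hp⟩, rfl⟩
  have hXQ : UCent.matG N (Fin.rev 0) 0 ∈ Q := ⟨⟨_, UCent.corner_mem N⟩, hX, rfl⟩
  have hpb : ∀ a ∈ Q, ∀ b ∈ Q, UCent.PoissonAlg.pb a b ∈ Q := by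
    rintro _ ⟨a, ha, rfl⟩ _ ⟨b, hb, rfl⟩
    exact ⟨UCent.PoissonAlg.pb a b, UCent.pb_mem_poissonAdjoin ha hb, rfl⟩
  have hrow : ∀ k : Fin N, (UCent.matG N * UCent.matX N ^ (k : ℕ)) (Fin.rev 0) 0 ∈ Q := by
    intro k
    -- The bracket of $\mathrm{tr}\,x^{k+1}$ with $X$ gives $(gx^k)_{N1}$ up to a nonzero factor and
    -- the correction $\frac1N\mathrm{tr}(x^k)X\in Q$. For $k=0$ the bracket is $0$ and the
    -- correction is $X$ itself.
    have h1 := hpb _ (hcQ _ (UCent.trace_pow_mem_coadjInv (k + 1))) _ hXQ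
    rw [UCent.pb_trace_pow_matG] at h1
    have hk : ((k : ℕ) + 1 : ℂ) / (2 * N) ≠ 0 :=
      div_ne_zero (Nat.cast_add_one_ne_zero _) (UCent.cN k)
    have h2 := Q.smul_mem h1 (((k : ℕ) + 1 : ℂ) / (2 * N))⁻¹
    rw [smul_smul, inv_mul_cancel₀ hk, one_smul] at h2
    have h3 := Q.smul_mem (mul_mem (hcQ _ (UCent.trace_pow_mem_coadjInv k)) hXQ) (1 / N : ℂ)
    have h4 := add_mem h2 h3
    rwa [sub_add_cancel] at h4
  rw [eq_top_iff]
  rintro z -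
  obtain ⟨F, rfl⟩ := Ideal.Quotient.mk_surjective (I := UCent.kwInvIdeal N) z
  -- The normal form is applied to the tautological point of the level set, the quotient map by
  -- `kwIdeal`: the restriction of $F$ agrees with that of some $a$ in $Q$.
  obtain ⟨_, ⟨a, ha, rfl⟩, hab⟩ := UCent.apply_mem_map_of_mem_kwInv F.2
    (φ := Ideal.Quotient.mkₐ ℂ (UCent.kwIdeal N))
    (fun a ha => Ideal.Quotient.eq_zero_iff_mem.2 ha) Q
    (fun k => hcQ _ (UCent.charpoly_coeff_mem_coadjInv k)) hrow
  have : Ideal.Quotient.mk (UCent.kwInvIdeal N) F = Ideal.Quotient.mk (UCent.kwInvIdeal N) a := by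
    rw [eq_comm, Ideal.Quotient.eq]
    have hab' : (a : UCent.CotSL N) - F ∈ UCent.kwIdeal N := Ideal.Quotient.eq.1 hab
    exact hab'
  rw [this]
  exact ha
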